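/- Let $\mathbb{T}$ be the set of all finite words over the alphabet $\{1,2\}$, with root the empty word $\varnothing$; the parent of a nonempty word is obtained by deleting its last letter. Let $\omega_{\mathbf i}=(\tau_{\mathbf i},\kappa_{\mathbf i})$, $\mathbf i\in\mathbb{T}$, be i.i.d. and uniformly distributed on $[0,1]\times\{1,2\}$. For $A\subset\mathbb{T}$ write $\mathbf i\overset{A}{\longrightarrow}\infty$ if there is a sequence $(j_k)_{k\ge 1}$ in $\{1,2\}$ such that $j_{k+1}\le\kappa_{\mathbf i j_1\cdots j_k}$ and $\mathbf i j_1\cdots j_k\in A$ for all $k\ge 0$. For $0\le t\le 1$ let $\mathbb{T}^t:=\{\mathbf i:\kappa_{\mathbf i}=1,\ \tau_{\mathbf i}\le t\}\cup\{\mathbf i:\kappa_{\mathbf i}=2\}$. Given a set $\Xi\subset(0,1]$, a random subset $\mathbb{F}\subset\mathbb{T}$, defined on the same probability space as $(\omega_{\mathbf i})_{\mathbf i\in\mathbb{T}}$, is a solution of the frozen percolation equation for $\Xi$ if almost surely, for all $\mathbf i\in\mathbb{T}$, $$\mathbf i\in\mathbb{F}\iff\kappa_{\mathbf i}=1\ \text{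 and }\ \mathbf i1\overset{\mathbb{T}^t\setminus\mathbb{F}}{\longrightarrow}\infty\ \text{ for some } t\in\Xi\cap(0,\tau_{\mathbf i}].$$ For $\mathbf j\in\mathbb{T}$ let $\Omega_{\mathbf j}:=(\omega_{\mathbf j\mathbf i})_{\mathbf i\in\mathbb{T}}$ and $\mathbb{F}_{\mathbf j}:=\{\mathbf i\in\mathbb{T}:\mathbf j\mathbf i\in\mathbb{F}\}$, and let $\Omega:=\Omega_\varnothing$. A rooted subtree is a set $\mathbb{U}\subset\mathbb{T}$ that contains the parent of each of its nonempty words; its boundary $\partial\mathbb{U}$ is the set of nonempty words outside $\mathbb{U}$ whose parent lies in $\mathbb{U}$, with the convention $\partial\emptyset:=\{\varnothing\}$. A solution $\mathbb{F}$ is called (a) stationary if the law of $(\Omega_{\mathbf j},\mathbb{F}_{\mathbf j})$ does not depend on $\mathbf j\in\mathbb{T}$; (b) adapted if for each finite rooted subtree $\mathbb{U}$ the family $(\Omega_{\mathbf j},\mathbb{F}_{\mathbf j})_{\mathbf j\in\partial\mathbb{U}}$ is independent of $(\omega_{\mathbf i})_{\mathbf i\in\mathbb{U}}$; (c) tree-respecting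 if for each finite rooted subtree $\mathbb{U}$ the random variables $(\Omega_{\mathbf j},\mathbb{F}_{\mathbf j})$, $\mathbf j\in\partial\mathbb{U}$, are independent. Theorem. Let $\Xi\subset(0,1]$ be closed in the relative topology of $(0,1]$. Then, on a suitable probability space, there exist $(\omega_{\mathbf i})_{\mathbf i\in\mathbb{T}}$ as above and a solution $\mathbb{F}$ of the frozen percolation equation for $\Xi$ that is stationary, adapted and tree-respecting. Moreover, the joint law of $(\Omega,\mathbb{F})$ is the same for all solutions of the frozen percolation equation for $\Xi$ that satisfy these three conditions, whatever probability space they are defined on. -/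

import Mathlib

open MeasureTheory ProbabilityTheory

namespace FrozenPerc

/-- The two-letter alphabet `{1, 2}`, encoded in an order-preserving way by `Fin 2`
(so `0 : Fin 2` stands for `1` and `1 : Fin 2` stands for `2`). -/
abbrev Letter : Type := Fin 2

/-- The letter (or number) `1`. -/
abbrev one : Letter := 0

/-- The letter (or number) `2`. -/
abbrev two : Letter := 1

/-- The oriented binary tree: all finite words over the alphabet `{1, 2}`.  The root is the empty
word, concatenation is `++`, the offspring of `i` are `i ++ [one]` and `i ++ [two]`, and the parent
of a nonempty word `i` is `i.dropLast`. -/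
abbrev Tree : Type := List Letter

/-- The mark `(τ, κ)` of a point: its activation time `τ ∈ [0,1]` and its number of legal
offspring `κ ∈ {1, 2}` (encoded like the letters). -/
abbrev Mark : Type := unitInterval × Letter

/-- The uniform distribution on `[0,1] × {1,2}`. -/
noncomputable def markLaw : Measure Mark :=
  (volume : Measure unitInterval).prod (PMF.uniformOfFintype Letter).toMeasure

/-- The activation time of the point `i`. -/
def tau (w : Tree → Mark) (i : Tree) : ℝ := ((w i).1 : ℝ)

/-- The number of legal offspring of the point `i`. -/
def kappa (w : Tree → Mark) (i : Tree) : Letter := (w i).2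

/-- The word `i j₁ ⋯ j_k`, where `j_{l+1}` is written `j l`. -/
def pathPoint (i : Tree) (j : ℕ → Letter) (k : ℕ) : Tree := i ++ (List.range k).map j

/-- There is an infinite path upwards through `A`, starting at `i`, such that each next point is a
legal offspring of its parent. -/
def Percolates (w : Tree → Mark) (A : Set Tree) (i : Tree) : Prop :=
  ∃ j : ℕ → Letter, ∀ k : ℕ, j k ≤ kappa w (pathPoint i j k) ∧ pathPoint i j k ∈ A

/-- The set of points that are either an internal point activated by time `t`, or a branching
point. -/
def activated (w : Tree → Mark) (t : ℝ) : Set Tree :=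
  {i | kappa w i = one ∧ tau w i ≤ t} ∪ {i | kappa w i = two}

/-- The set `F` solves the frozen percolation equation with marks `w` for the set `Ξ ⊆ (0,1]` of
possible freezing times. -/
def SolvesFrozen (Ξ : Set (Set.Ioc (0 : ℝ) 1)) (w : Tree → Mark) (F : Set Tree) : Prop :=
  ∀ i : Tree, i ∈ F ↔
    kappa w i = one ∧
      ∃ t ∈ Ξ, (t : ℝ) ≤ tau w i ∧ Percolates w (activated w (t : ℝ) \ F) (i ++ [one])

/-- The pair `(Ω_j, 𝔽_j)`: the marks and the set as seen from the point `j`. -/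
def shift (j : Tree) (p : (Tree → Mark) × Set Tree) : (Tree → Mark) × Set Tree :=
  (fun i => p.1 (j ++ i), {i | j ++ i ∈ p.2})

/-- A rooted subtree: a (possibly empty) set of words closed under taking parents. -/
def IsRootedSubtree (U : Set Tree) : Prop :=
  ∀ i ∈ U, i ≠ [] → i.dropLast ∈ U

/-- The boundary of a rooted subtree: the points outside `U` with parent in `U`, with the
convention that the boundary of the empty set consists of the root. -/
def boundary (U : Set Tree) : Set Tree :=
  {i | (U = ∅ ∧ i = []) ∨ (i ∉ U ∧ i ≠ [] ∧ i.dropLast ∈ U)}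

section

variable {S : Type*} [MeasurableSpace S]

/-- The marks `(ω_i)` are i.i.d. and uniformly distributed on `[0,1] × {1,2}`. -/
structure IsIIDUniform (P : Measure S) (ω : S → Tree → Mark) : Prop where
  measurable : ∀ i, Measurable fun s => ω s i
  indep : iIndepFun (fun (i : Tree) (s : S) => ω s i) P
  law : ∀ i, P.map (fun s => ω s i) = markLaw

/-- `F` is a random subset of the tree that almost surely solves the frozen percolation equation
for the marks `ω`. -/
structure IsSolution (Ξ : Set (Set.Ioc (0 : ℝ) 1)) (P : Measure S)
    (ω : S → Tree → Mark) (F : S → Set Tree) : Prop where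
  measurable : ∀ i, MeasurableSet {s | i ∈ F s}
  solves : ∀ᵐ s ∂P, SolvesFrozen Ξ (ω s) (F s)

/-- The law of `(Ω_j, 𝔽_j)` does not depend on `j`. -/
def IsStationary (P : Measure S) (ω : S → Tree → Mark) (F : S → Set Tree) : Prop :=
  ∀ j j' : Tree,
    P.map (fun s => shift j (ω s, F s)) = P.map (fun s => shift j' (ω s, F s))

/-- For each finite rooted subtree `U`, the family `(Ω_j, 𝔽_j)` with `j` in the boundary of `U` is
independent of the family of marks inside `U`. -/
def IsAdapted (P : Measure S) (ω : S → Tree → Mark) (F : S → Set Tree) : Prop :=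
  ∀ U : Set Tree, U.Finite → IsRootedSubtree U →
    IndepFun (fun (s : S) (j : boundary U) => shift (j : Tree) (ω s, F s))
      (fun (s : S) (i : U) => ω s (i : Tree)) P

/-- For each finite rooted subtree `U`, the pairs `(Ω_j, 𝔽_j)` with `j` in the boundary of `U` are
independent of each other. -/
def RespectsTree (P : Measure S) (ω : S → Tree → Mark) (F : S → Set Tree) : Prop :=
  ∀ U : Set Tree, U.Finite → IsRootedSubtree U →
    iIndepFun (fun (j : boundary U) (s : S) => shift (j : Tree) (ω s, F s)) P

/-- On the probability space `(S, P)`, the marks `ω` are i.i.d. uniform and `F` is a solution of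
the frozen percolation equation that is stationary, adapted, and respects the tree structure. -/
structure IsNiceSolution (Ξ : Set (Set.Ioc (0 : ℝ) 1)) (P : Measure S)
    (ω : S → Tree → Mark) (F : S → Set Tree) : Prop where
  iid : IsIIDUniform P ω
  solution : IsSolution Ξ P ω F
  stationary : IsStationary P ω F
  adapted : IsAdapted P ω F
  respectsTree : RespectsTree P ω F

end

end FrozenPerc

namespace FrozenPerc

open Set Filter Topology
open scoped ENNReal

/-! For a solution let `Y_i` be the first time in `Ξ` at which `i` percolates, with the value 2 for
"never". Up to null sets, `i` is frozen exactly when `κ_i = 1` and `Y_{i1} ≤ τ_i`, so `𝔽` is a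
function of the marks and the times `Y`. These times satisfy `Y_i = freezeStep (ω_i, Y_{i1},
Y_{i2})`. Under the three conditions, marks and times form a recursive tree process (`IsRTP`), and
its law is determined by the law `ρ` of `Y_∅` (`IsRTP.unique`). Everything therefore reduces to
identifying `ρ`.

Write `G(t) = ρ (Iic t)`. Invariance under the recursion says `G(t)² = ∫_{y ≤ t} y dG(y)` for `t <
2`. This has many solutions carried by `Ξ ∪ {2}`. A process built from one of them solves the frozen
percolation equation only if a point with `Y > t` does not percolate at time `t ∈ Ξ`. The
probability `p` of such a violation satisfies `p (p - (t - 2G(t))) = 0`; together with a monotone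
iteration this shows that violations are null exactly when `t ≤ 2G(t)` (`IsRTP.ae_not_percolatesBy`,
`IsRTP.le_two_mul`). A law with all these properties is an `IsFreezingLaw`.

Uniqueness of the freezing law: for two of them, with distribution functions `G` and `H`, the lower
bound sharpens to `x ≤ H(x) + H(x-)` for `G`-almost every `x < 2`, and symmetrically
(`IsBalanced.ofReal_le`). Integrating and adding, integration by parts gives `G² + H² ≤ 2GH`, so `G
= H`. Existence: finite `Ξ` is treated by adding points from left to right. A closed `Ξ` is
approximated by finite nets, and the same inequality with an error `ε` makes the distribution
functions uniformly Cauchy.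

Given a freezing law, the tree process is sampled upwards from the root by disintegration
(`exists_isRTP`), and reading off the frozen points gives a solution with the three properties. -/

/-! ### Freezing laws: uniqueness -/

/-- The equation satisfied by the distribution function `G` of a law of percolation times, namely
`G(t)² = ∫_{y ≤ t} y dG(y)` for `t < 2`; the value `2` stands for "never". -/
def IsBalanced (ρ : Measure ℝ) : Prop :=
  ∀ t < 2, ρ (Iic t) ^ 2 = ∫⁻ y in Iic t, ENNReal.ofReal y ∂ρ

/-- The law of the percolation time of a point in a frozen percolation process. -/
structure IsFreezingLaw (Ξ : Set ℝ) (ρ : Measure ℝ) : Prop where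
  prob : IsProbabilityMeasure ρ
  support : ρ (Ξ ∪ {2})ᶜ = 0
  balanced : IsBalanced ρ
  lower : ∀ t ∈ Ξ, ENNReal.ofReal t ≤ 2 * ρ (Iic t)

/-- Integration by parts: the square `Iic t ×ˢ Iic t` is cut along the diagonal. The diagonal
belongs to the first piece only, whence `Iic` in one integral and `Iio` in the other. -/
lemma measure_Iic_mul_measure_Iic (ρ σ : Measure ℝ) [IsFiniteMeasure ρ] [IsFiniteMeasure σ]
    (t : ℝ) :
    ρ (Iic t) * σ (Iic t) =
      ∫⁻ x in Iic t, σ (Iic x) ∂ρ + ∫⁻ y in Iic t, ρ (Iio y) ∂σ := by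
  have h1 : MeasurableSet {p : ℝ × ℝ | p.2 ≤ p.1 ∧ p.1 ≤ t} :=
    (measurableSet_le measurable_snd measurable_fst).inter
      (measurableSet_le measurable_fst measurable_const)
  have h2 : MeasurableSet {p : ℝ × ℝ | p.1 < p.2 ∧ p.2 ≤ t} :=
    (measurableSet_lt measurable_fst measurable_snd).inter
      (measurableSet_le measurable_snd measurable_const)
  have h3 : Iic t ×ˢ Iic t =
      {p : ℝ × ℝ | p.2 ≤ p.1 ∧ p.1 ≤ t} ∪ {p : ℝ × ℝ | p.1 < p.2 ∧ p.2 ≤ t} := by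
    ext ⟨x, y⟩
    simp only [mem_prod, mem_Iic, mem_union, mem_ofPred_eq]
    constructor
    · rintro ⟨hx, hy⟩
      rcases le_or_gt y x with h | h
      · exact Or.inl ⟨h, hx⟩
      · exact Or.inr ⟨h, hy⟩
    · rintro (⟨h, hx⟩ | ⟨h, hy⟩)
      · exact ⟨hx, h.trans hx⟩
      · exact ⟨h.le.trans hy, hy⟩
  have h4 : Disjoint {p : ℝ × ℝ | p.2 ≤ p.1 ∧ p.1 ≤ t} {p : ℝ × ℝ | p.1 < p.2 ∧ p.2 ≤ t} := by
    rw [Set.disjoint_left]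
    rintro ⟨x, y⟩ ⟨h, _⟩ ⟨h', _⟩
    exact absurd h (not_le.2 h')
  rw [← Measure.prod_prod, h3, measure_union h4 h2, Measure.prod_apply h1,
    Measure.prod_apply_symm h2, ← lintegral_indicator measurableSet_Iic,
    ← lintegral_indicator measurableSet_Iic]
  congr 1
  · refine lintegral_congr fun x => ?_
    by_cases hx : x ≤ t
    · rw [indicator_of_mem (mem_Iic.2 hx)]
      congr 1
      ext y
      simp [hx]
    · rw [indicator_of_notMem (by simpa using hx)]
      convert measure_empty (μ := σ)
      ext y
      simp [hx]
  · refine lintegral_congr fun x => ?_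
    by_cases hx : x ≤ t
    · rw [indicator_of_mem (mem_Iic.2 hx)]
      congr 1
      ext y
      simp [hx]
    · rw [indicator_of_notMem (by simpa using hx)]
      convert measure_empty (μ := ρ)
      ext y
      simp [hx]

lemma measurable_measure_Iic (σ : Measure ℝ) : Measurable fun x => σ (Iic x) :=
  Monotone.measurable fun _ _ h => measure_mono (Iic_subset_Iic.2 h)

/-- Balance turns the squares into integrals of `y`, which `h1` and `h2` bound by four integrals;
these pair up under two integrations by parts. The result says that the difference of the two
distribution functions at `t` has square at most `2ε`. -/
lemma IsBalanced.sq_add_sq_le {ρ σ : Measure ℝ} [IsProbabilityMeasure ρ] [IsProbabilityMeasure σ]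
    (hρ : IsBalanced ρ) (hσ : IsBalanced σ) {t : ℝ} (ht : t < 2) {ε : ℝ≥0∞}
    (h1 : ∀ᵐ x ∂ρ, x ≤ t → ENNReal.ofReal x ≤ σ (Iic x) + σ (Iio x) + ε)
    (h2 : ∀ᵐ x ∂σ, x ≤ t → ENNReal.ofReal x ≤ ρ (Iic x) + ρ (Iio x) + ε) :
    ρ (Iic t) ^ 2 + σ (Iic t) ^ 2 ≤ 2 * (ρ (Iic t) * σ (Iic t)) + 2 * ε := by
  have key : ∀ {α β : Measure ℝ} [IsProbabilityMeasure α] [IsProbabilityMeasure β],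
      (∀ᵐ x ∂α, x ≤ t → ENNReal.ofReal x ≤ β (Iic x) + β (Iio x) + ε) →
      ∫⁻ y in Iic t, ENNReal.ofReal y ∂α ≤
        ∫⁻ x in Iic t, β (Iic x) ∂α + ∫⁻ x in Iic t, β (Iio x) ∂α + ε := by
    intro α β _ _ h
    calc ∫⁻ y in Iic t, ENNReal.ofReal y ∂α
        ≤ ∫⁻ x in Iic t, (β (Iic x) + β (Iio x) + ε) ∂α := by
          refine lintegral_mono_ae ?_
          rw [ae_restrict_iff' measurableSet_Iic]
          exact h
      _ = ∫⁻ x in Iic t, β (Iic x) ∂α + ∫⁻ x in Iic t, β (Iio x) ∂α + ε * α (Iic t) := by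
          rw [lintegral_add_right _ measurable_const, lintegral_add_left (measurable_measure_Iic β),
            setLIntegral_const]
      _ ≤ _ := by
          gcongr
          exact mul_le_of_le_one_right' prob_le_one
  have e1 := measure_Iic_mul_measure_Iic ρ σ t
  have e2 := measure_Iic_mul_measure_Iic σ ρ t
  rw [hρ t ht, hσ t ht]
  refine (add_le_add (key h1) (key h2)).trans_eq ?_
  rw [two_mul (ρ (Iic t) * σ (Iic t))]
  nth_rewrite 1 [e1]
  rw [mul_comm (ρ (Iic t)), e2]
  ring

lemma IsBalanced.sq_measure_Iio {σ : Measure ℝ} [IsProbabilityMeasure σ] (hσ : IsBalanced σ) {x : ℝ}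
    (hx : x < 2) : σ (Iio x) ^ 2 = ∫⁻ y in Iio x, ENNReal.ofReal y ∂σ := by
  obtain ⟨u, hu, hux, hlim⟩ := exists_seq_strictMono_tendsto x
  have hU : Iio x = ⋃ n, Iic (u n) := by
    ext y
    simp only [mem_Iio, mem_iUnion, mem_Iic]
    constructor
    · intro hy
      obtain ⟨n, hn⟩ := (hlim.eventually (lt_mem_nhds hy)).exists
      exact ⟨n, hn.le⟩
    · rintro ⟨n, hn⟩
      exact hn.trans_lt (hux n)
  have hmono : Monotone fun n => Iic (u n) := fun a b h => Iic_subset_Iic.2 (hu.monotone h)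
  have t1 : Tendsto (fun n => σ (Iic (u n)) ^ 2) atTop (𝓝 (σ (Iio x) ^ 2)) := by
    rw [hU]
    exact ENNReal.Tendsto.pow (tendsto_measure_iUnion_atTop hmono)
  have t2 : Tendsto (fun n => σ.withDensity (fun y => ENNReal.ofReal y) (Iic (u n))) atTop
      (𝓝 (σ.withDensity (fun y => ENNReal.ofReal y) (Iio x))) := by
    rw [hU]
    exact tendsto_measure_iUnion_atTop hmono
  rw [withDensity_apply _ measurableSet_Iio] at t2
  refine tendsto_nhds_unique t1 (t2.congr fun n => ?_)
  rw [withDensity_apply _ measurableSet_Iic, hσ _ ((hux n).trans hx)]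

/-- Subtracting the balance equations on `Iio x` and `Iic x` gives `σ{x} (σ(Iic x) + σ(Iio x)) = x
σ{x}`. At an atom the bound is thus an equality; without an atom `Iic x` and `Iio x` have equal mass
and the hypothesis is the claim. -/
lemma IsBalanced.ofReal_le {σ : Measure ℝ} [IsProbabilityMeasure σ] (hσ : IsBalanced σ) {x : ℝ}
    (hx : x < 2) {ε : ℝ≥0∞} (h : ENNReal.ofReal x ≤ 2 * σ (Iic x) + ε) :
    ENNReal.ofReal x ≤ σ (Iic x) + σ (Iio x) + ε := by
  have hsplit : σ (Iic x) = σ (Iio x) + σ {x} := by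
    rw [← Iio_union_right, measure_union (by simp) (measurableSet_singleton x)]
  have hsq : σ (Iic x) ^ 2 = σ (Iio x) ^ 2 + ENNReal.ofReal x * σ {x} := by
    rw [hσ x hx, hσ.sq_measure_Iio hx, ← Iio_union_right,
      lintegral_union (measurableSet_singleton x) (by simp)]
    simp [mul_comm]
  by_cases h0 : σ {x} = 0
  · rw [hsplit, h0, add_zero] at h ⊢
    rwa [two_mul] at h
  · have h3 : σ {x} * (σ (Iic x) + σ (Iio x)) = σ {x} * ENNReal.ofReal x := by
      have : σ (Iio x) ^ 2 ≠ ∞ := by finiteness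
      rw [hsplit] at hsq ⊢
      refine (ENNReal.add_right_inj this).1 ?_
      rw [mul_comm _ (ENNReal.ofReal x), ← hsq]
      ring
    rw [(ENNReal.mul_right_inj h0 (by finiteness)).1 h3]
    exact le_self_add

lemma IsFreezingLaw.measure_Iic_of_two_le {Ξ : Set ℝ} {ρ : Measure ℝ} (hρ : IsFreezingLaw Ξ ρ)
    (hΞ : Ξ ⊆ Ioc 0 1) {t : ℝ} (ht : 2 ≤ t) : ρ (Iic t) = 1 := by
  have := hρ.prob
  refine le_antisymm prob_le_one ?_
  rw [← measure_univ (μ := ρ), ← measure_inter_add_sdiff univ measurableSet_Iic (t := Iic t)]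
  have : ρ (univ \ Iic t) = 0 := by
    refine measure_mono_null ?_ hρ.support
    rintro x ⟨-, hx⟩ (h | h)
    · exact hx ((hΞ h).2.trans (by linarith))
    · rw [mem_singleton_iff] at h
      exact hx (by rw [h]; exact ht)
  rw [this, add_zero]
  exact measure_mono inter_subset_right

lemma IsFreezingLaw.unique {Ξ : Set ℝ} (hΞ : Ξ ⊆ Ioc 0 1) {ρ σ : Measure ℝ}
    (hρ : IsFreezingLaw Ξ ρ) (hσ : IsFreezingLaw Ξ σ) : ρ = σ := by
  have := hρ.prob
  have := hσ.prob
  refine Measure.ext_of_Iic _ _ fun t => ?_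
  rcases lt_or_ge t 2 with ht | ht
  · have key : ∀ {α β : Measure ℝ}, IsFreezingLaw Ξ α → IsFreezingLaw Ξ β →
        ∀ᵐ x ∂α, x ≤ t → ENNReal.ofReal x ≤ β (Iic x) + β (Iio x) + 0 := by
      intro α β hα hβ
      have := hβ.prob
      have : ∀ᵐ x ∂α, x ∈ Ξ ∪ {2} := hα.support
      filter_upwards [this] with x hx hxt
      have hx2 : x < 2 := hxt.trans_lt ht
      refine hβ.balanced.ofReal_le hx2 ?_
      rw [add_zero]
      rcases hx with hx | hx
      · exact hβ.lower x hx
      · exact absurd hx hx2.ne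
    have h := hρ.balanced.sq_add_sq_le hσ.balanced ht (key hρ hσ) (key hσ hρ)
    have h' : (ρ.real (Iic t)) ^ 2 + (σ.real (Iic t)) ^ 2 ≤
        2 * (ρ.real (Iic t) * σ.real (Iic t)) := by
      have := ENNReal.toReal_mono (by finiteness) h
      rw [ENNReal.toReal_add (by finiteness) (by finiteness)] at this
      simpa [Measure.real] using this
    rw [← measureReal_eq_measureReal_iff]
    nlinarith [sq_nonneg (ρ.real (Iic t) - σ.real (Iic t))]
  · rw [hρ.measure_Iic_of_two_le hΞ ht, hσ.measure_Iic_of_two_le hΞ ht]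

/-! ### Freezing laws: existence -/

/-- Add the largest point `a` last. If `a ≤ 2G(a-)` nothing changes; otherwise `a` receives an atom
and the remaining mass is moved to 2. -/
lemma exists_isFreezingLaw_finset (s : Finset ℝ) (hs : (s : Set ℝ) ⊆ Ioc 0 1) :
    ∃ ρ : Measure ℝ, IsFreezingLaw (s : Set ℝ) ρ := by
  induction s using Finset.induction_on_max with
  | empty =>
    refine ⟨Measure.dirac 2, inferInstance, by simp, fun t ht => ?_, by simp⟩
    have h2 : (2 : ℝ) ∉ Iic t := by simpa using ht
    rw [restrict_dirac' measurableSet_Iic, if_neg h2]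
    simp [ht]
  | insert a s ha ih =>
    obtain ⟨ρ, hρ⟩ := ih fun x hx => hs (by simp at hx ⊢; exact Or.inr hx)
    have hprob := hρ.prob
    have haI : a ∈ Ioc (0 : ℝ) 1 := hs (by simp)
    have ha2 : a < 2 := haI.2.trans_lt (by norm_num)
    rcases le_or_gt (ENNReal.ofReal a) (2 * ρ (Iio a)) with hle | hlt
    · refine ⟨ρ, hprob, measure_mono_null ?_ hρ.support, hρ.balanced, fun t ht => ?_⟩
      · rw [compl_subset_compl]
        refine union_subset_union_left _ ?_
        simp
      · rw [Finset.coe_insert] at ht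
        rcases ht with rfl | ht
        · exact hle.trans (by gcongr; exact Iio_subset_Iic_self)
        · exact hρ.lower t ht
    -- The atom is forced by balance: `(G + Δ)² = G² + aΔ` with `G = G(a-)` and `Δ ≠ 0` means `a =
    -- 2G + Δ`.
    · obtain ⟨Δ, hΔ⟩ : ∃ Δ, ENNReal.ofReal a = 2 * ρ (Iio a) + Δ := le_iff_exists_add.1 hlt.le
      have hle1 : ρ (Iio a) + Δ ≤ 1 := by
        calc ρ (Iio a) + Δ ≤ 2 * ρ (Iio a) + Δ := by
              gcongr
              rw [two_mul]
              exact le_self_add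
          _ ≤ 1 := by
              rw [← hΔ]
              exact ENNReal.ofReal_le_one.2 haI.2
      obtain ⟨R, hR⟩ : ∃ R, (1 : ℝ≥0∞) = ρ (Iio a) + Δ + R := le_iff_exists_add.1 hle1
      set σ : Measure ℝ := ρ.restrict (Iio a) + Δ • Measure.dirac a + R • Measure.dirac 2 with hσ
      have hr1 : ∀ t < a, σ.restrict (Iic t) = ρ.restrict (Iic t) := by
        intro t ht
        have h2 : (2 : ℝ) ∉ Iic t := by simp only [mem_Iic, not_le]; linarith
        have h3 : a ∉ Iic t := by simpa using ht
        have h4 : Iic t ∩ Iio a = Iic t :=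
          inter_eq_left.2 fun x hx => lt_of_le_of_lt hx ht
        rw [hσ, Measure.restrict_add, Measure.restrict_add, Measure.restrict_smul,
          Measure.restrict_smul, restrict_dirac' measurableSet_Iic,
          restrict_dirac' measurableSet_Iic, if_neg h2, if_neg h3,
          Measure.restrict_restrict measurableSet_Iic, h4]
        simp
      have hr2 : ∀ t, a ≤ t → t < 2 →
          σ.restrict (Iic t) = ρ.restrict (Iio a) + Δ • Measure.dirac a := by
        intro t ht ht2
        have h2 : (2 : ℝ) ∉ Iic t := by simpa using ht2
        have h4 : Iic t ∩ Iio a = Iio a :=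
          inter_eq_right.2 fun x hx => (mem_Iio.1 hx).le.trans ht
        rw [hσ, Measure.restrict_add, Measure.restrict_add, Measure.restrict_smul,
          Measure.restrict_smul, restrict_dirac' measurableSet_Iic,
          restrict_dirac' measurableSet_Iic, if_neg h2, if_pos (mem_Iic.2 ht),
          Measure.restrict_restrict measurableSet_Iic, h4]
        simp
      have hm1 : ∀ t < a, σ (Iic t) = ρ (Iic t) := fun t ht => by
        rw [← Measure.restrict_apply_univ, hr1 t ht, Measure.restrict_apply_univ]
      have hm2 : ∀ t, a ≤ t → t < 2 → σ (Iic t) = ρ (Iio a) + Δ := fun t ht ht2 => by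
        rw [← Measure.restrict_apply_univ, hr2 t ht ht2]
        simp
      refine ⟨σ, ⟨?_⟩, ?_, fun t ht => ?_, fun t ht => ?_⟩
      · rw [hR]
        simp [hσ]
      · have h1 : ρ ((insert a (s : Set ℝ) ∪ {2})ᶜ ∩ Iio a) = 0 := by
          refine measure_mono_null ?_ hρ.support
          rintro x ⟨hx, -⟩ hx'
          exact hx (union_subset_union_left _ (subset_insert _ _) hx')
        have hms : MeasurableSet (insert a (s : Set ℝ) ∪ {2})ᶜ :=
          ((s.finite_toSet.insert a).union (finite_singleton 2)).measurableSet.compl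
        rw [Finset.coe_insert, hσ, Measure.add_apply, Measure.add_apply, Measure.smul_apply,
          Measure.smul_apply, Measure.restrict_apply hms, h1, Measure.dirac_apply' _ hms,
          Measure.dirac_apply' _ hms]
        simp
      · rcases lt_or_ge t a with hta | hta
        · rw [hm1 t hta, hr1 t hta]
          exact hρ.balanced t ht
        · rw [hm2 t hta ht, hr2 t hta ht, lintegral_add_measure, lintegral_smul_measure,
            lintegral_dirac, ← hρ.balanced.sq_measure_Iio ha2, hΔ, smul_eq_mul]
          ring
      · rw [Finset.coe_insert] at ht
        rcases ht with rfl | ht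
        · rw [hm2 t le_rfl ha2, hΔ, mul_add]
          gcongr
          exact le_mul_of_one_le_left' (by norm_num)
        · rw [hm1 t (ha t ht)]
          exact hρ.lower t ht

lemma exists_finset_net {Ξ : Set ℝ} (hΞ : Ξ ⊆ Ioc 0 1)
    (hcl : ∀ x ∈ Ioc (0 : ℝ) 1, x ∈ closure Ξ → x ∈ Ξ) {ε : ℝ} (hε : 0 < ε) :
    ∃ s : Finset ℝ, (s : Set ℝ) ⊆ Ξ ∧ ∀ x ∈ Ξ, x ≤ ε ∨ ∃ t ∈ s, t ≤ x ∧ x ≤ t + ε := by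
  classical
  -- The net consists of the first points of `Ξ` after the multiples `kε`. Only `k ≥ 1` is used,
  -- because for `k = 0` the infimum may be 0, which is not in `Ξ`.
  let f : ℕ → ℝ := fun k => sInf (Ξ ∩ Ici (k * ε))
  have hbdd : ∀ k : ℕ, BddBelow (Ξ ∩ Ici (k * ε)) := fun k => ⟨k * ε, fun x hx => hx.2⟩
  have hf : ∀ k : ℕ, 1 ≤ k → (Ξ ∩ Ici (k * ε)).Nonempty → f k ∈ Ξ := by
    intro k hk hne
    have h1 : k * ε ≤ f k := le_csInf hne fun x hx => hx.2
    have h2 : 0 < k * ε := by positivity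
    obtain ⟨y, hy⟩ := hne
    have h3 : f k ≤ 1 := (csInf_le (hbdd k) hy).trans (hΞ hy.1).2
    exact hcl _ ⟨h2.trans_le h1, h3⟩
      (closure_mono inter_subset_left (csInf_mem_closure ⟨y, hy⟩ (hbdd k)))
  obtain ⟨K, hK⟩ := exists_nat_gt (1 / ε)
  refine ⟨((Finset.range K).filter fun k : ℕ => 1 ≤ k ∧ (Ξ ∩ Ici (k * ε)).Nonempty).image f,
    ?_, fun x hx => ?_⟩
  · intro x hx
    simp only [Finset.coe_image, mem_image, Finset.mem_coe, Finset.mem_filter] at hx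
    obtain ⟨k, ⟨-, hk, hne⟩, rfl⟩ := hx
    exact hf k hk hne
  · rcases le_or_gt x ε with h | h
    · exact Or.inl h
    right
    have hk1 : 1 ≤ ⌊x / ε⌋₊ := Nat.le_floor (by rw [Nat.cast_one, le_div_iff₀ hε]; linarith)
    have hk2 : (⌊x / ε⌋₊ : ℝ) * ε ≤ x := by
      rw [← le_div_iff₀ hε]
      exact Nat.floor_le (div_nonneg (hΞ hx).1.le hε.le)
    have hk3 : x < (⌊x / ε⌋₊ + 1) * ε := by
      rw [← div_lt_iff₀ hε]
      exact Nat.lt_floor_add_one _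
    have hmem : x ∈ Ξ ∩ Ici (⌊x / ε⌋₊ * ε) := ⟨hx, hk2⟩
    refine ⟨f ⌊x / ε⌋₊, ?_, csInf_le (hbdd _) hmem, ?_⟩
    · refine Finset.mem_image_of_mem f (Finset.mem_filter.2 ⟨?_, hk1, ⟨x, hmem⟩⟩)
      rw [Finset.mem_range]
      have : (⌊x / ε⌋₊ : ℝ) < K := by
        refine lt_of_le_of_lt ?_ hK
        rw [le_div_iff₀ hε]
        exact hk2.trans (hΞ hx).2
      exact_mod_cast this
    · have : (⌊x / ε⌋₊ : ℝ) * ε ≤ f ⌊x / ε⌋₊ := le_csInf ⟨x, hmem⟩ fun y hy => hy.2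
      linarith

/-- The layer-cake formula expresses the integral through masses of intervals, so that pointwise
convergence of distribution functions suffices to pass to the limit in the balance equation. -/
lemma setLIntegral_Iic_ofReal (ν : Measure ℝ) (h0 : ν (Iio 0) = 0) (t : ℝ) :
    ∫⁻ y in Iic t, ENNReal.ofReal y ∂ν = ∫⁻ u in Ioi 0, ν (Ioc u t) := by
  rw [lintegral_eq_lintegral_meas_lt (ν.restrict (Iic t)) (f := fun y => y) ?_ (by fun_prop)]
  · refine lintegral_congr fun u => ?_
    have : MeasurableSet {a : ℝ | u < a} := measurableSet_Ioi
    rw [Measure.restrict_apply this]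
    rfl
  · refine ae_restrict_of_ae ?_
    have : ∀ᵐ x ∂ν, x ∉ Iio 0 := measure_eq_zero_iff_ae_notMem.1 h0
    filter_upwards [this] with x hx
    simpa using hx

/-- A pointwise limit of balanced laws on `[0, ∞)` is balanced. -/
lemma IsBalanced.of_tendsto {ρ : ℕ → Measure ℝ} {σ : Measure ℝ} [∀ n, IsProbabilityMeasure (ρ n)]
    (hρ : ∀ n, IsBalanced (ρ n)) (h0 : ∀ n, ρ n (Iio 0) = 0) (hσ0 : σ (Iio 0) = 0)
    (hIic : ∀ t, Tendsto (fun n => ρ n (Iic t)) atTop (𝓝 (σ (Iic t))))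
    (hIoc : ∀ u t, Tendsto (fun n => ρ n (Ioc u t)) atTop (𝓝 (σ (Ioc u t)))) :
    IsBalanced σ := by
  intro t ht
  have h1 : Tendsto (fun n => ρ n (Iic t) ^ 2) atTop (𝓝 (σ (Iic t) ^ 2)) :=
    ENNReal.Tendsto.pow (hIic t)
  have h2 : Tendsto (fun n => ∫⁻ u in Ioi 0, ρ n (Ioc u t)) atTop
      (𝓝 (∫⁻ u in Ioi 0, σ (Ioc u t))) := by
    refine tendsto_lintegral_of_dominated_convergence ((Iic t).indicator 1) (fun n => ?_)
      (fun n => ?_) ?_ (ae_of_all _ fun u => hIoc u t)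
    · exact Antitone.measurable fun a b hab => measure_mono (Ioc_subset_Ioc_left hab)
    · refine ae_of_all _ fun u => ?_
      by_cases hu : u ≤ t
      · rw [indicator_of_mem (mem_Iic.2 hu)]
        exact prob_le_one
      · simp only [Ioc_eq_empty (fun h : u < t => hu h.le), measure_empty, zero_le]
    · rw [lintegral_indicator measurableSet_Iic]
      simp only [Pi.one_apply, lintegral_const, one_mul,
        Measure.restrict_apply MeasurableSet.univ, Measure.restrict_apply measurableSet_Iic,
        univ_inter]
      rw [inter_comm, Ioi_inter_Iic]
      exact measure_Ioc_lt_top.ne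
  rw [setLIntegral_Iic_ofReal σ hσ0]
  refine tendsto_nhds_unique h1 (h2.congr fun n => ?_)
  rw [← setLIntegral_Iic_ofReal (ρ n) (h0 n), hρ n t ht]

/-- A uniformly Cauchy sequence of distribution functions that are constant outside of a bounded
interval converges to a distribution function. -/
lemma exists_measure_tendsto_cdf {ρ : ℕ → Measure ℝ} [∀ n, IsProbabilityMeasure (ρ n)]
    {a b : ℝ} (ha : ∀ n, ∀ t ≤ a, cdf (ρ n) t = 0) (hb : ∀ n t, b ≤ t → cdf (ρ n) t = 1)
    (hC : UniformCauchySeqOn (fun n t => cdf (ρ n) t) atTop univ) :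
    ∃ σ : Measure ℝ, IsProbabilityMeasure σ ∧
      ∀ t, Tendsto (fun n => cdf (ρ n) t) atTop (𝓝 (cdf σ t)) := by
  choose G hG using fun t : ℝ => cauchySeq_tendsto_of_complete (hC.cauchySeq (mem_univ t))
  have hunif : TendstoUniformly (fun n t => cdf (ρ n) t) G atTop := by
    rw [← tendstoUniformlyOn_univ]
    exact hC.tendstoUniformlyOn_of_tendsto fun t _ => hG t
  let S : StieltjesFunction ℝ :=
    { toFun := G
      mono' := fun x y hxy => le_of_tendsto_of_tendsto' (hG x) (hG y) fun n => (cdf (ρ n)).mono hxy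
      right_continuous' := fun x => by
        -- Right-continuity survives because the convergence is uniform.
        refine continuousWithinAt_of_locally_uniform_approx_of_continuousWithinAt
          self_mem_Ici fun u hu => ?_
        obtain ⟨n, hn⟩ := (hunif u hu).exists
        exact ⟨univ, univ_mem, _, (cdf (ρ n)).right_continuous x, fun y _ => hn y⟩ }
  have hG0 : ∀ t ≤ a, G t = 0 := fun t ht =>
    tendsto_nhds_unique (hG t) (tendsto_const_nhds.congr fun n => (ha n t ht).symm)
  have hG1 : ∀ t, b ≤ t → G t = 1 := fun t ht =>
    tendsto_nhds_unique (hG t) (tendsto_const_nhds.congr fun n => (hb n t ht).symm)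
  have hS0 : Tendsto S atBot (𝓝 0) :=
    tendsto_const_nhds.congr' ((eventually_le_atBot a).mono fun t ht => (hG0 t ht).symm)
  have hS1 : Tendsto S atTop (𝓝 1) :=
    tendsto_const_nhds.congr' ((eventually_ge_atTop b).mono fun t ht => (hG1 t ht).symm)
  refine ⟨S.measure, S.isProbabilityMeasure hS0 hS1, fun t => ?_⟩
  rw [cdf_measure_stieltjesFunction S hS0 hS1]
  exact hG t

lemma measure_Ioc_eq_ofReal_cdf (ρ : Measure ℝ) [IsProbabilityMeasure ρ] (u t : ℝ) :
    ρ (Ioc u t) = ENNReal.ofReal (cdf ρ t - cdf ρ u) := by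
  conv_lhs => rw [← measure_cdf ρ]
  exact StieltjesFunction.measure_Ioc _ _ _

lemma IsFreezingLaw.measure_Iic_of_nonpos {Ξ : Set ℝ} {ρ : Measure ℝ} (hρ : IsFreezingLaw Ξ ρ)
    (hΞ : Ξ ⊆ Ioc 0 1) {t : ℝ} (ht : t ≤ 0) : ρ (Iic t) = 0 := by
  refine measure_mono_null ?_ hρ.support
  rintro x hx (h | h)
  · exact absurd ((hΞ h).1.trans_le hx) (not_lt.2 ht)
  · rw [mem_singleton_iff] at h
    rw [mem_Iic, h] at hx
    linarith

/-- Two freezing laws for subsets of `Ξ` have close distribution functions if both almost satisfy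
the lower bound on `Ξ`. -/
lemma IsFreezingLaw.abs_cdf_sub_cdf_le {Ξ s s' : Set ℝ} (hΞ : Ξ ⊆ Ioc 0 1) (hs : s ⊆ Ξ)
    (hs' : s' ⊆ Ξ) {ρ σ : Measure ℝ} (hρ : IsFreezingLaw s ρ) (hσ : IsFreezingLaw s' σ) {ε : ℝ}
    (hε : 0 ≤ ε) (h1 : ∀ x ∈ Ξ, ENNReal.ofReal x ≤ 2 * ρ (Iic x) + ENNReal.ofReal ε)
    (h2 : ∀ x ∈ Ξ, ENNReal.ofReal x ≤ 2 * σ (Iic x) + ENNReal.ofReal ε) (t : ℝ) :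
    |cdf ρ t - cdf σ t| ≤ √(2 * ε) := by
  have := hρ.prob
  have := hσ.prob
  rw [cdf_eq_real, cdf_eq_real]
  rcases lt_or_ge t 2 with ht | ht
  · have key : ∀ {r : Set ℝ} {α β : Measure ℝ} [IsProbabilityMeasure β], r ⊆ Ξ →
        IsFreezingLaw r α → IsBalanced β →
        (∀ x ∈ Ξ, ENNReal.ofReal x ≤ 2 * β (Iic x) + ENNReal.ofReal ε) →
        ∀ᵐ x ∂α, x ≤ t → ENNReal.ofReal x ≤ β (Iic x) + β (Iio x) + ENNReal.ofReal ε := by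
      intro r α β _ hr hα hβ h
      have : ∀ᵐ x ∂α, x ∈ r ∪ {2} := hα.support
      filter_upwards [this] with x hx hxt
      have hx2 : x < 2 := hxt.trans_lt ht
      refine hβ.ofReal_le hx2 ?_
      rcases hx with hx | hx
      · exact h x (hr hx)
      · exact absurd hx hx2.ne
    have h := hρ.balanced.sq_add_sq_le hσ.balanced ht (key hs hρ hσ.balanced h2)
      (key hs' hσ hρ.balanced h1)
    have h' := ENNReal.toReal_mono (by finiteness) h
    rw [ENNReal.toReal_add (by finiteness) (by finiteness),
      ENNReal.toReal_add (by finiteness) (by finiteness)] at h'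
    simp only [ENNReal.toReal_pow, ENNReal.toReal_mul, ENNReal.toReal_ofNat,
      ENNReal.toReal_ofReal hε] at h'
    refine Real.abs_le_sqrt ?_
    simp only [Measure.real]
    nlinarith [h']
  · rw [Measure.real, Measure.real, hρ.measure_Iic_of_two_le (hs.trans hΞ) ht,
      hσ.measure_Iic_of_two_le (hs'.trans hΞ) ht]
    simp

/-- A freezing law of a `1/(n+1)`-net satisfies the lower bound on all of `Ξ` up to `1/(n+1)`.
`IsFreezingLaw.abs_cdf_sub_cdf_le` then makes the sequence uniformly Cauchy, and all defining
properties pass to the limit. -/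
theorem exists_isFreezingLaw {Ξ : Set ℝ} (hΞ : Ξ ⊆ Ioc 0 1)
    (hcl : ∀ x ∈ Ioc (0 : ℝ) 1, x ∈ closure Ξ → x ∈ Ξ) : ∃ ρ, IsFreezingLaw Ξ ρ := by
  have hε : ∀ n : ℕ, (0 : ℝ) < 1 / (n + 1) := fun n => Nat.one_div_pos_of_nat
  choose s hs hnet using fun n : ℕ => exists_finset_net hΞ hcl (hε n)
  choose ρ hρ using fun n : ℕ => exists_isFreezingLaw_finset (s n) ((hs n).trans hΞ)
  have hprob : ∀ n, IsProbabilityMeasure (ρ n) := fun n => (hρ n).prob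
  have hlow : ∀ n, ∀ x ∈ Ξ,
      ENNReal.ofReal x ≤ 2 * ρ n (Iic x) + ENNReal.ofReal (1 / (n + 1)) := by
    intro n x hx
    rcases hnet n x hx with h | ⟨t, ht, htx, hxt⟩
    · exact (ENNReal.ofReal_le_ofReal h).trans le_add_self
    · calc ENNReal.ofReal x ≤ ENNReal.ofReal t + ENNReal.ofReal (1 / (n + 1)) := by
            rw [← ENNReal.ofReal_add (hΞ (hs n ht)).1.le (hε n).le]
            exact ENNReal.ofReal_le_ofReal hxt
        _ ≤ _ := by
            gcongr
            exact ((hρ n).lower t ht).trans (by gcongr)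
  have hC : UniformCauchySeqOn (fun n t => cdf (ρ n) t) atTop univ := by
    rw [Metric.uniformCauchySeqOn_iff]
    intro δ hδ
    -- The distance of two distribution functions is at most `√(2ε)`, so `ε < δ²/2` is needed.
    obtain ⟨N, hN⟩ := exists_nat_one_div_lt (show 0 < δ ^ 2 / 2 by positivity)
    have hlow' : ∀ n ≥ N, ∀ x ∈ Ξ,
        ENNReal.ofReal x ≤ 2 * ρ n (Iic x) + ENNReal.ofReal (1 / (N + 1)) := by
      intro n hn x hx
      refine (hlow n x hx).trans ?_
      gcongr
    refine ⟨N, fun m hm n hn t _ => ?_⟩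
    rw [Real.dist_eq]
    refine ((hρ m).abs_cdf_sub_cdf_le hΞ (hs m) (hs n) (hρ n) (hε N).le (hlow' m hm)
      (hlow' n hn) t).trans_lt ?_
    rw [Real.sqrt_lt' hδ]
    linarith
  obtain ⟨σ, hσ, hlim⟩ := exists_measure_tendsto_cdf (ρ := ρ) (a := 0) (b := 2)
    (fun n t ht => by
      rw [cdf_eq_real, Measure.real, (hρ n).measure_Iic_of_nonpos ((hs n).trans hΞ) ht]; rfl)
    (fun n t ht => by
      rw [cdf_eq_real, Measure.real, (hρ n).measure_Iic_of_two_le ((hs n).trans hΞ) ht]; rfl) hC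
  have hIic : ∀ t, Tendsto (fun n => ρ n (Iic t)) atTop (𝓝 (σ (Iic t))) := by
    intro t
    simp_rw [← ofReal_cdf]
    exact ENNReal.tendsto_ofReal (hlim t)
  have hIoc : ∀ u t, Tendsto (fun n => ρ n (Ioc u t)) atTop (𝓝 (σ (Ioc u t))) := by
    intro u t
    simp_rw [measure_Ioc_eq_ofReal_cdf]
    exact ENNReal.tendsto_ofReal ((hlim t).sub (hlim u))
  have hσ0 : σ (Iic 0) = 0 := tendsto_nhds_unique (hIic 0)
    (tendsto_const_nhds.congr fun n =>
      ((hρ n).measure_Iic_of_nonpos ((hs n).trans hΞ) le_rfl).symm)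
  have hσ2 : σ (Ioi 2) = 0 := by
    have h1 : σ (Iic 2) = 1 := tendsto_nhds_unique (hIic 2)
      (tendsto_const_nhds.congr fun n =>
        ((hρ n).measure_Iic_of_two_le ((hs n).trans hΞ) le_rfl).symm)
    rw [← compl_Iic]
    exact (prob_compl_eq_zero_iff measurableSet_Iic).2 h1
  refine ⟨σ, hσ, ?_, IsBalanced.of_tendsto (fun n => (hρ n).balanced) (fun n => ?_) ?_ hIic hIoc,
    fun t ht => ?_⟩
  -- Convergence on intervals controls only the open complement of `closure Ξ ∪ {2}`. The closure
  -- adds at most the point 0 to `Ξ`, and `Iic 0` has no mass.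
  · have hK : σ (closure Ξ ∪ {2})ᶜ = 0 := by
      refine measure_null_of_locally_null _ fun x hx => ?_
      have hopen : IsOpen (closure Ξ ∪ {2})ᶜ :=
        (isClosed_closure.union isClosed_singleton).isOpen_compl
      obtain ⟨δ, hδ, hball⟩ := Metric.isOpen_iff.1 hopen x hx
      have hsub : Ioc (x - δ / 2) (x + δ / 2) ⊆ (Ξ ∪ {2})ᶜ := by
        intro y hy
        have hy' : y ∈ Metric.ball x δ := by
          rw [Metric.mem_ball, Real.dist_eq, abs_lt]
          constructor <;> linarith [hy.1, hy.2]
        exact fun h => hball hy' (union_subset_union_left _ subset_closure h)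
      refine ⟨Ioc (x - δ / 2) (x + δ / 2), mem_nhdsWithin_of_mem_nhds
        (Ioc_mem_nhds (by linarith) (by linarith)), ?_⟩
      refine tendsto_nhds_unique (hIoc _ _) (tendsto_const_nhds.congr fun n => ?_)
      refine (measure_mono_null (hsub.trans ?_) (hρ n).support).symm
      exact compl_subset_compl.2 (union_subset_union_left _ (hs n))
    refine measure_mono_null ?_ (measure_union_null (measure_union_null hσ0 hσ2) hK)
    intro x hx
    by_contra hcon
    rw [mem_union, mem_union, not_or, not_or, notMem_compl_iff, mem_Iic, not_le] at hcon
    obtain ⟨⟨h0, -⟩, h | h⟩ := hcon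
    · have hx1 : x ≤ 1 := by
        have : closure Ξ ⊆ Iic 1 := closure_minimal (fun y hy => (hΞ hy).2) isClosed_Iic
        exact this h
      exact hx (Or.inl (hcl x ⟨h0, hx1⟩ h))
    · exact hx (Or.inr h)
  · exact measure_mono_null Iio_subset_Iic_self
      ((hρ n).measure_Iic_of_nonpos ((hs n).trans hΞ) le_rfl)
  · exact measure_mono_null Iio_subset_Iic_self hσ0
  · have h1 : Tendsto (fun n : ℕ => 2 * ρ n (Iic t) + ENNReal.ofReal (1 / (n + 1))) atTop
        (𝓝 (2 * σ (Iic t) + ENNReal.ofReal 0)) :=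
      (ENNReal.Tendsto.const_mul (hIic t) (Or.inr (by simp))).add
        (ENNReal.tendsto_ofReal tendsto_one_div_add_atTop_nhds_zero_nat)
    rw [ENNReal.ofReal_zero, add_zero] at h1
    exact ge_of_tendsto' h1 fun n => hlow n t ht

/-! ### Labelled trees split at the root -/

instance : IsProbabilityMeasure markLaw := by
  unfold markLaw
  infer_instance

section Graft

variable {X : Type*}

/-- The labelled tree above the offspring `a` of the root. -/
def branch (a : Letter) (z : Tree → X) : Tree → X := fun i => z (a :: i)

/-- The label of the root, together with the labelled trees above its two offspring. -/
def split (z : Tree → X) : X × (Tree → X) × (Tree → X) := (z [], branch one z, branch two z)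

/-- The labelled tree with given label at the root and given trees above its two offspring. -/
def graft (p : X × (Tree → X) × (Tree → X)) : Tree → X
  | [] => p.1
  | a :: i => if a = one then p.2.1 i else p.2.2 i

lemma split_graft (p : X × (Tree → X) × (Tree → X)) : split (graft p) = p := by
  refine Prod.ext rfl (Prod.ext ?_ ?_) <;> funext i <;> simp [split, branch, graft]

variable [MeasurableSpace X]

@[fun_prop]
lemma measurable_branch (a : Letter) : Measurable (branch a : (Tree → X) → Tree → X) :=
  measurable_pi_lambda _ fun _ => measurable_pi_apply _

@[fun_prop]
lemma measurable_split : Measurable (split : (Tree → X) → _) :=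
  (measurable_pi_apply _).prodMk ((measurable_branch one).prodMk (measurable_branch two))

@[fun_prop]
lemma measurable_graft : Measurable (graft : _ → Tree → X) := by
  refine measurable_pi_lambda _ fun i => ?_
  match i with
  | [] => exact measurable_fst
  | a :: i =>
    by_cases h : a = one
    · simp only [graft, if_pos h]
      fun_prop
    · simp only [graft, if_neg h]
      fun_prop

lemma prod_finset_tree {M : Type*} [CommMonoid M] (s : Finset Tree) (f : Tree → M) :
    ∏ i ∈ s, f i = (if [] ∈ s then f [] else 1) *
      ((∏ i ∈ s.preimage (List.cons one) List.cons_injective.injOn, f (one :: i)) *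
        ∏ i ∈ s.preimage (List.cons two) List.cons_injective.injOn, f (two :: i)) := by
  classical
  rw [← Finset.prod_filter_mul_prod_filter_not s (fun i => i = []) f]
  congr 1
  · rw [Finset.prod_filter]
    convert Finset.prod_ite_eq' s [] f
  · rw [Finset.prod_preimage' (List.cons one) s List.cons_injective.injOn f,
      Finset.prod_preimage' (List.cons two) s List.cons_injective.injOn f, ← Finset.prod_union]
    · refine Finset.prod_congr ?_ fun _ _ => rfl
      ext i
      simp only [Finset.mem_filter, Finset.mem_union, mem_range]
      match i with
      | [] => simp
      | a :: i => fin_cases a <;> simp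
    · rw [Finset.disjoint_left]
      rintro i hi hi'
      obtain ⟨-, j, rfl⟩ := Finset.mem_filter.1 hi
      obtain ⟨-, k, hk⟩ := Finset.mem_filter.1 hi'
      simp at hk

/-- A tree labelled with i.i.d. labels consists of a root label and two independent trees of the
same kind. -/
lemma measurePreserving_split_infinitePi (μ : Measure X) [IsProbabilityMeasure μ] :
    MeasurePreserving split (Measure.infinitePi fun _ : Tree => μ)
      (μ.prod ((Measure.infinitePi fun _ : Tree => μ).prod (Measure.infinitePi fun _ : Tree => μ))) := by
  set ν := Measure.infinitePi fun _ : Tree => μ with hν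
  -- It is easier to show that grafting independent pieces gives the product law; `split` then
  -- undoes `graft`.
  have key : (μ.prod (ν.prod ν)).map graft = ν := by
    rw [hν]
    refine Measure.eq_infinitePi (fun _ : Tree => μ) fun s t ht => ?_
    have hset : graft ⁻¹' (Set.pi s t) = (if [] ∈ s then t [] else univ) ×ˢ
        ((Set.pi (s.preimage (List.cons one) List.cons_injective.injOn) fun i => t (one :: i)) ×ˢ
         (Set.pi (s.preimage (List.cons two) List.cons_injective.injOn) fun i => t (two :: i))) := by
      ext ⟨x, z0, z1⟩
      simp only [mem_preimage, Set.mem_pi, mem_prod, Finset.coe_preimage, Finset.mem_coe]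
      constructor
      · intro h
        refine ⟨?_, fun i hi => ?_, fun i hi => ?_⟩
        · split_ifs with h0
          · exact h [] h0
          · trivial
        · simpa [graft] using h _ hi
        · simpa [graft] using h _ hi
      · rintro ⟨h1, h2, h3⟩ i hi
        match i with
        | [] =>
          rw [if_pos hi] at h1
          exact h1
        | a :: i =>
          fin_cases a
          · simpa [graft] using h2 i hi
          · simpa [graft] using h3 i hi
    rw [Measure.map_apply measurable_graft
        (MeasurableSet.pi s.countable_toSet fun i _ => ht i), hset,
      Measure.prod_prod, Measure.prod_prod, Measure.infinitePi_pi _ fun i _ => ht _,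
      Measure.infinitePi_pi _ fun i _ => ht _, prod_finset_tree s]
    congr 1
    split_ifs
    · rfl
    · simp
  refine ⟨measurable_split, ?_⟩
  nth_rewrite 1 [← key]
  rw [Measure.map_map measurable_split measurable_graft]
  have : (split ∘ graft : X × (Tree → X) × (Tree → X) → _) = id := funext split_graft
  rw [this, Measure.map_id]

end Graft

/-! ### Recursive tree processes: uniqueness -/

/-- The percolation time of a point with a given mark, as a function of the percolation times of its
two offspring; the value `2` stands for "never". -/
noncomputable def freezeStep (p : Mark × ℝ × ℝ) : ℝ :=
  if p.1.2 = one then (if p.2.1 ≤ p.1.1 then 2 else p.2.1) else min p.2.1 p.2.2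

@[fun_prop]
lemma measurable_freezeStep : Measurable freezeStep := by
  unfold freezeStep
  refine Measurable.ite ?_ (Measurable.ite ?_ measurable_const (by fun_prop)) (by fun_prop)
  · exact (measurableSet_singleton one).preimage (by fun_prop : Measurable fun p : Mark × ℝ × ℝ => p.1.2)
  · exact measurableSet_le (by fun_prop) (by fun_prop)

/-- A tree of marks and percolation times. -/
abbrev MTree : Type := Tree → Mark × ℝ

/-- The mark of the root, together with the marked trees above its two offspring. -/
def decompose (z : MTree) : Mark × MTree × MTree := ((z []).1, branch one z, branch two z)

/-- The percolation time of the root. -/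
def rootTime (z : MTree) : ℝ := (z []).2

@[fun_prop]
lemma measurable_decompose : Measurable decompose :=
  (measurable_fst.comp (measurable_pi_apply _)).prodMk
    ((measurable_branch one).prodMk (measurable_branch two))

@[fun_prop]
lemma measurable_rootTime : Measurable rootTime := measurable_snd.comp (measurable_pi_apply _)

/-- A recursive tree process: the mark of the root is uniformly distributed and independent of
the trees above the offspring of the root, which are independent and have the same law as the whole
tree, and the percolation time of the root is a function of its mark and of the percolation times
of its offspring. -/
structure IsRTP (μ : Measure MTree) : Prop where
  prob : IsProbabilityMeasure μ
  map_decompose : μ.map decompose = markLaw.prod (μ.prod μ)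
  step : ∀ᵐ z ∂μ,
    rootTime z = freezeStep ((z []).1, rootTime (branch one z), rootTime (branch two z))

lemma IsRTP.measurePreserving {μ : Measure MTree} (hμ : IsRTP μ) :
    MeasurePreserving decompose μ (markLaw.prod (μ.prod μ)) :=
  ⟨measurable_decompose, hμ.map_decompose⟩

/-- A labelled tree up to and including generation `n - 1`, together with the percolation times in
generation `n`. -/
def trunc : ℕ → MTree → MTree
  | 0, z => fun _ => ((0, one), rootTime z)
  | n + 1, z => graft (z [], trunc n (branch one z), trunc n (branch two z))

@[fun_prop]
lemma measurable_trunc (n : ℕ) : Measurable (trunc n) := by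
  induction n with
  | zero =>
    change Measurable fun z : MTree => fun _ : Tree => (((0, one), rootTime z) : Mark × ℝ)
    fun_prop
  | succ n ih =>
    change Measurable fun z : MTree =>
      (graft (z [], trunc n (branch one z), trunc n (branch two z)) : MTree)
    fun_prop

lemma rootTime_trunc (n : ℕ) (z : MTree) : rootTime (trunc n z) = rootTime z := by
  cases n <;> rfl

lemma trunc_apply (n : ℕ) (z : MTree) (i : Tree) (hi : i.length < n) : trunc n z i = z i := by
  induction n generalizing z i with
  | zero => simp at hi
  | succ n ih =>
    match i with
    | [] => rfl
    | a :: i =>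
      have hi' : i.length < n := by simpa using hi
      fin_cases a
      · simpa [trunc, graft, branch] using ih (branch one z) i hi'
      · simpa [trunc, graft, branch] using ih (branch two z) i hi'

/-- The tree with given mark at the root and given trees above the offspring of the root. -/
noncomputable def compose (p : Mark × MTree × MTree) : MTree :=
  graft ((p.1, freezeStep (p.1, rootTime p.2.1, rootTime p.2.2)), p.2.1, p.2.2)

@[fun_prop]
lemma measurable_compose : Measurable compose := by
  unfold compose
  fun_prop

/-- Truncation keeps the root time of each branch, and the root time of the whole tree is almost
surely recomputed from these by `freezeStep`. Hence the law at level `n` determines the law at level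
`n + 1`. -/
lemma IsRTP.map_trunc {μ : Measure MTree} (hμ : IsRTP μ) (n : ℕ) :
    μ.map (trunc (n + 1)) =
      (markLaw.prod ((μ.map (trunc n)).prod (μ.map (trunc n)))).map compose := by
  have := hμ.prob
  have h1 : trunc (n + 1) =ᵐ[μ]
      (fun p : Mark × MTree × MTree => compose (p.1, trunc n p.2.1, trunc n p.2.2)) ∘ decompose := by
    filter_upwards [hμ.step] with z hz
    simp only [trunc, compose, Function.comp, decompose, rootTime_trunc, ← hz]
    rfl
  rw [Measure.map_congr h1, ← Measure.map_map (by fun_prop) (by fun_prop), hμ.map_decompose,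
    Measure.map_prod_map _ _ (by fun_prop) (by fun_prop)]
  nth_rewrite 2 [← Measure.map_id (μ := markLaw)]
  rw [Measure.map_prod_map _ _ (by fun_prop) (by fun_prop),
    Measure.map_map (by fun_prop) (by fun_prop)]
  rfl

/-- Level 0 records only the root time, so all truncations have equal laws by induction. Any finite
set of points lies below some level, which gives the finite-dimensional laws. -/
lemma IsRTP.unique {μ μ' : Measure MTree} (hμ : IsRTP μ) (hμ' : IsRTP μ')
    (h : μ.map rootTime = μ'.map rootTime) : μ = μ' := by
  have := hμ.prob
  have := hμ'.prob
  have htr : ∀ n, μ.map (trunc n) = μ'.map (trunc n) := by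
    intro n
    induction n with
    | zero =>
      have h0 : trunc 0 = (fun y : ℝ => (fun _ => ((0, one), y) : MTree)) ∘ rootTime := rfl
      rw [h0, ← Measure.map_map (by fun_prop) (by fun_prop), h,
        Measure.map_map (by fun_prop) (by fun_prop)]
    | succ n ih => rw [hμ.map_trunc, hμ'.map_trunc, ih]
  refine IsProjectiveLimit.unique (P := fun I : Finset Tree => μ.map I.restrict)
    (fun I => rfl) (fun I => ?_)
  have hI : I.restrict = I.restrict ∘ trunc (I.sup List.length + 1) := by
    funext z i
    exact (trunc_apply _ z i (Nat.lt_succ_of_le (Finset.le_sup i.2))).symm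
  change μ'.map I.restrict = μ.map I.restrict
  rw [hI, ← Measure.map_map (by fun_prop) (by fun_prop), ← htr,
    Measure.map_map (by fun_prop) (by fun_prop)]

/-! ### Recursive tree processes: existence -/

section Regroup

variable {α β γ δ : Type*} [MeasurableSpace α] [MeasurableSpace β] [MeasurableSpace γ]
  [MeasurableSpace δ]

lemma measurePreserving_prodProdProdComm (μα : Measure α) (μβ : Measure β) (μγ : Measure γ)
    (μδ : Measure δ) [SFinite μα] [SFinite μβ] [SFinite μγ] [SFinite μδ] :
    MeasurePreserving (fun p : (α × β) × γ × δ => ((p.1.1, p.2.1), (p.1.2, p.2.2)))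
      ((μα.prod μβ).prod (μγ.prod μδ)) ((μα.prod μγ).prod (μβ.prod μδ)) := by
  have e1 := measurePreserving_prodAssoc μα μβ (μγ.prod μδ)
  have e2 : MeasurePreserving (fun p : β × γ × δ => (p.2.1, p.1, p.2.2))
      (μβ.prod (μγ.prod μδ)) (μγ.prod (μβ.prod μδ)) :=
    (measurePreserving_prodAssoc μγ μβ μδ).comp
      ((Measure.measurePreserving_swap.prod (MeasurePreserving.id μδ)).comp
        ((measurePreserving_prodAssoc μβ μγ μδ).symm MeasurableEquiv.prodAssoc))
  exact ((measurePreserving_prodAssoc μα μγ (μβ.prod μδ)).symm MeasurableEquiv.prodAssoc).comp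
    (((MeasurePreserving.id μα).prod e2).comp e1)

end Regroup

/-- A law on a product whose first marginal is `ρ` can be sampled by first sampling from `ρ` and
then using an independent uniformly distributed random variable. -/
lemma exists_measurePreserving_uniform {α β : Type*} [MeasurableSpace α] [MeasurableSpace β]
    [StandardBorelSpace β] [Nonempty β] (π : Measure (α × β)) [IsProbabilityMeasure π] :
    ∃ f : α × unitInterval → β, Measurable f ∧
      MeasurePreserving (fun p => (p.1, f p)) (π.fst.prod (volume : Measure unitInterval)) π := by
  obtain ⟨f, hf, hfκ⟩ := Kernel.exists_measurable_map_eq_unitInterval π.condKernel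
  refine ⟨fun p => f p.1 p.2, hf, by fun_prop, ?_⟩
  ext s hs
  conv_rhs => rw [← π.disintegrate π.condKernel, Measure.compProd_apply hs]
  have hm : Measurable fun p : α × unitInterval => (p.1, f p.1 p.2) :=
    measurable_fst.prodMk hf
  rw [Measure.map_apply hm hs, Measure.prod_apply (hm hs)]
  refine lintegral_congr fun a => ?_
  have hfa : Measurable (f a) := hf.comp measurable_prodMk_left
  rw [← hfκ, Measure.map_apply hfa (measurable_prodMk_left hs)]
  rfl

/-- The tree of marks and percolation times that is constructed upwards from the percolation time of
the root and a tree of noise variables. -/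
def buildUp (φ : ℝ × unitInterval → Mark × ℝ × ℝ) :
    ℝ × (Tree → unitInterval) → MTree
  | (y, u), [] => ((φ (y, u [])).1, y)
  | (y, u), a :: i =>
    if a = one then buildUp φ ((φ (y, u [])).2.1, branch one u) i
    else buildUp φ ((φ (y, u [])).2.2, branch two u) i

@[fun_prop]
lemma measurable_buildUp {φ : ℝ × unitInterval → Mark × ℝ × ℝ} (hφ : Measurable φ) :
    Measurable (buildUp φ) := by
  refine measurable_pi_lambda _ fun i => ?_
  induction i with
  | nil =>
    change Measurable fun p : ℝ × (Tree → unitInterval) => ((φ (p.1, p.2 [])).1, p.1)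
    fun_prop
  | cons a i ih =>
    by_cases h : a = one
    · have : (fun p : ℝ × (Tree → unitInterval) => buildUp φ p (a :: i)) =
          (fun q => buildUp φ q i) ∘ fun p => ((φ (p.1, p.2 [])).2.1, branch one p.2) := by
        funext p
        simp [buildUp, h]
      rw [this]
      exact ih.comp (by fun_prop)
    · have : (fun p : ℝ × (Tree → unitInterval) => buildUp φ p (a :: i)) =
          (fun q => buildUp φ q i) ∘ fun p => ((φ (p.1, p.2 [])).2.2, branch two p.2) := by
        funext p
        simp [buildUp, h]
      rw [this]
      exact ih.comp (by fun_prop)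

lemma decompose_buildUp (φ : ℝ × unitInterval → Mark × ℝ × ℝ) (y : ℝ)
    (u : Tree → unitInterval) :
    decompose (buildUp φ (y, u)) =
      ((φ (y, u [])).1, buildUp φ ((φ (y, u [])).2.1, branch one u),
        buildUp φ ((φ (y, u [])).2.2, branch two u)) := by
  refine Prod.ext rfl (Prod.ext ?_ ?_) <;> funext i <;> simp [decompose, branch, buildUp]

/-- By invariance, the law `π` of `(freezeStep p, p)` has first marginal `ρ`. Disintegrating `π`
gives a map `φ` that samples, from a root time and a uniform variable, the root mark and the two
offspring times with the right conditional law; `buildUp` iterates it with independent noise. -/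
theorem exists_isRTP {ρ : Measure ℝ} [IsProbabilityMeasure ρ]
    (h : (markLaw.prod (ρ.prod ρ)).map freezeStep = ρ) :
    ∃ μ, IsRTP μ ∧ μ.map rootTime = ρ := by
  set Q := markLaw.prod (ρ.prod ρ) with hQ
  have hgraph : Measurable fun p : Mark × ℝ × ℝ => (freezeStep p, p) := by fun_prop
  set π := Q.map fun p => (freezeStep p, p) with hπ
  have : IsProbabilityMeasure π := Measure.isProbabilityMeasure_map hgraph.aemeasurable
  have hfst : π.fst = ρ := by
    rw [Measure.fst, hπ, Measure.map_map measurable_fst hgraph]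
    exact h
  obtain ⟨φ, hφ, hφπ⟩ := exists_measurePreserving_uniform π
  rw [hfst] at hφπ
  set ν := Measure.infinitePi fun _ : Tree => (volume : Measure unitInterval) with hν
  -- Unconditionally, the mark and the two offspring times are independent and the times again have
  -- law `ρ`; this makes the construction self-similar.
  have hφQ : MeasurePreserving φ (ρ.prod volume) Q := by
    have : MeasurePreserving Prod.snd π Q := by
      refine ⟨measurable_snd, ?_⟩
      rw [hπ, Measure.map_map measurable_snd hgraph]
      exact Measure.map_id
    exact this.comp hφπ
  have hsplit : MeasurePreserving split ν (volume.prod (ν.prod ν)) :=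
    measurePreserving_split_infinitePi volume
  have hb := measurable_buildUp hφ
  have hnoise : MeasurePreserving
      (fun p : ℝ × (Tree → unitInterval) => ((p.1, p.2 []), (branch one p.2, branch two p.2)))
      (ρ.prod ν) ((ρ.prod volume).prod (ν.prod ν)) :=
    ((measurePreserving_prodAssoc ρ volume (ν.prod ν)).symm MeasurableEquiv.prodAssoc).comp
      ((MeasurePreserving.id ρ).prod hsplit)
  have hroot : MeasurePreserving (fun p : ℝ × (Tree → unitInterval) => (p.1, p.2 []))
      (ρ.prod ν) (ρ.prod volume) := measurePreserving_fst.comp hnoise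
  refine ⟨(ρ.prod ν).map (buildUp φ), ⟨?_, ?_, ?_⟩, ?_⟩
  · exact Measure.isProbabilityMeasure_map hb.aemeasurable
  · have hbp : MeasurePreserving (buildUp φ) (ρ.prod ν) ((ρ.prod ν).map (buildUp φ)) := ⟨hb, rfl⟩
    have h1 : MeasurePreserving (fun p : (Mark × ℝ × ℝ) × (Tree → unitInterval) × (Tree → unitInterval) =>
        (p.1.1, ((p.1.2.1, p.2.1), (p.1.2.2, p.2.2))))
        (Q.prod (ν.prod ν)) (markLaw.prod ((ρ.prod ν).prod (ρ.prod ν))) :=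
      ((MeasurePreserving.id markLaw).prod (measurePreserving_prodProdProdComm ρ ρ ν ν)).comp
        (measurePreserving_prodAssoc markLaw (ρ.prod ρ) (ν.prod ν))
    have h2 := (((MeasurePreserving.id markLaw).prod (hbp.prod hbp)).comp h1).comp
      ((hφQ.prod (MeasurePreserving.id (ν.prod ν))).comp hnoise)
    rw [Measure.map_map measurable_decompose hb]
    convert h2.map_eq using 2
    funext p
    exact decompose_buildUp φ p.1 p.2
  · rw [ae_map_iff hb.aemeasurable (measurableSet_eq_fun (by fun_prop) (by fun_prop))]
    have h3 : ∀ᵐ p ∂π, p.1 = freezeStep p.2 := by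
      rw [hπ, ae_map_iff hgraph.aemeasurable (measurableSet_eq_fun (by fun_prop) (by fun_prop))]
      exact ae_of_all _ fun _ => rfl
    have h4 := (hφπ.comp hroot).quasiMeasurePreserving.ae h3
    filter_upwards [h4] with p hp
    have hd := decompose_buildUp φ p.1 p.2
    simp only [decompose, Prod.mk.injEq, Prod.mk.eta] at hd
    obtain ⟨hd0, hd1, hd2⟩ := hd
    rw [hd0, hd1, hd2]
    exact hp
  · rw [Measure.map_map measurable_rootTime hb]
    exact measurePreserving_fst.map_eq

/-! ### Percolation from the root: recursion, compactness, measurability -/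

/-- The set of points that are activated by time `t` and not frozen. -/
def openSet (t : ℝ) (p : (Tree → Mark) × Set Tree) : Set Tree := activated p.1 t \ p.2

/-- At time `t`, the root percolates through activated points that are not frozen. -/
def PercolatesBy (t : ℝ) (p : (Tree → Mark) × Set Tree) : Prop := Percolates p.1 (openSet t p) []

/-- At time `t`, there is an open path from the root through `n` points. -/
def ReachesBy (t : ℝ) : ℕ → (Tree → Mark) × Set Tree → Prop
  | 0, _ => True
  | n + 1, p => [] ∈ openSet t p ∧ ∃ a ≤ (p.1 []).2, ReachesBy t n (shift [a] p)

lemma shift_shift (i j : Tree) (p : (Tree → Mark) × Set Tree) :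
    shift j (shift i p) = shift (i ++ j) p := by
  simp [shift]

lemma pathPoint_append (i l : Tree) (j : ℕ → Letter) (k : ℕ) :
    pathPoint (i ++ l) j k = i ++ pathPoint l j k :=
  List.append_assoc _ _ _

lemma pathPoint_succ (i : Tree) (j : ℕ → Letter) (k : ℕ) :
    pathPoint i j (k + 1) = pathPoint i j k ++ [j k] := by
  simp [pathPoint, List.range_succ]

lemma pathPoint_cons (i : Tree) (j : ℕ → Letter) (k : ℕ) :
    pathPoint i j (k + 1) = pathPoint (i ++ [j 0]) (fun n => j (n + 1)) k := by
  simp [pathPoint, List.range_succ_eq_map, Function.comp_def]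

lemma percolatesBy_shift (t : ℝ) (i : Tree) (p : (Tree → Mark) × Set Tree) :
    PercolatesBy t (shift i p) ↔ Percolates p.1 (openSet t p) i := by
  have h : ∀ j k, pathPoint i j k = i ++ pathPoint [] j k := fun j k => by
    rw [← pathPoint_append, List.append_nil]
  unfold PercolatesBy Percolates
  simp only [h]
  rfl

lemma mem_openSet_shift (t : ℝ) (i j : Tree) (p : (Tree → Mark) × Set Tree) :
    j ∈ openSet t (shift i p) ↔ i ++ j ∈ openSet t p := Iff.rfl

lemma nil_mem_openSet {t : ℝ} {p : (Tree → Mark) × Set Tree} :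
    [] ∈ openSet t p ↔ ((p.1 []).2 = one → ((p.1 []).1 : ℝ) ≤ t) ∧ [] ∉ p.2 := by
  have : ∀ a : Letter, a = one ∨ a = two := by decide
  have h01 : one ≠ two := by decide
  simp only [openSet, activated, Set.mem_sdiff, mem_union, mem_ofPred_eq, kappa, tau]
  rcases this (p.1 []).2 with h | h <;> simp [h]

lemma openSet_mono {s t : ℝ} (h : s ≤ t) (p : (Tree → Mark) × Set Tree) :
    openSet s p ⊆ openSet t p := by
  rintro i ⟨hi | hi, hp⟩
  · exact ⟨Or.inl ⟨hi.1, hi.2.trans h⟩, hp⟩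
  · exact ⟨Or.inr hi, hp⟩

lemma PercolatesBy.mono {s t : ℝ} (h : s ≤ t) {p : (Tree → Mark) × Set Tree}
    (hp : PercolatesBy s p) : PercolatesBy t p := by
  obtain ⟨j, hj⟩ := hp
  exact ⟨j, fun k => ⟨(hj k).1, openSet_mono h p (hj k).2⟩⟩

/-- The root percolates if it has a property that forces it to be open and that is inherited by
one of its legal offspring. -/
lemma percolatesBy_of_coinduction {t : ℝ} (C : (Tree → Mark) × Set Tree → Prop)
    (hC : ∀ p, C p → [] ∈ openSet t p ∧ ∃ a ≤ (p.1 []).2, C (shift [a] p))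
    {p : (Tree → Mark) × Set Tree} (hp : C p) : PercolatesBy t p := by
  have hC' : ∀ p, C p → ∃ a ≤ (p.1 []).2, C (shift [a] p) := fun p h => (hC p h).2
  choose! a ha using hC'
  let q : ℕ → (Tree → Mark) × Set Tree := fun k => (fun r => shift [a r] r)^[k] p
  have hq : ∀ k, q k = shift (pathPoint [] (fun k => a (q k)) k) p ∧ C (q k) := by
    intro k
    induction k with
    | zero => exact ⟨rfl, hp⟩
    | succ k ih =>
      have hs : q (k + 1) = shift [a (q k)] (q k) := Function.iterate_succ_apply' _ _ _
      refine ⟨?_, ?_⟩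
      · rw [hs, pathPoint_succ, ← shift_shift, ← ih.1]
      · rw [hs]
        exact (ha _ ih.2).2
  refine ⟨fun k => a (q k), fun k => ?_⟩
  obtain ⟨hk, hCk⟩ := hq k
  have h1 := (ha _ hCk).1
  have h2 := (hC _ hCk).1
  constructor
  · change a (q k) ≤ _
    refine h1.trans_eq ?_
    rw [hk]
    simp [shift, kappa]
  · rw [hk, mem_openSet_shift, List.append_nil] at h2
    exact h2

lemma percolatesBy_iff {t : ℝ} {p : (Tree → Mark) × Set Tree} :
    PercolatesBy t p ↔ [] ∈ openSet t p ∧ ∃ a ≤ (p.1 []).2, PercolatesBy t (shift [a] p) := by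
  have key : ∀ p, PercolatesBy t p →
      [] ∈ openSet t p ∧ ∃ a ≤ (p.1 []).2, PercolatesBy t (shift [a] p) := by
    rintro p ⟨j, hj⟩
    refine ⟨(hj 0).2, j 0, (hj 0).1, ?_⟩
    rw [percolatesBy_shift]
    refine ⟨fun n => j (n + 1), fun k => ?_⟩
    have := hj (k + 1)
    rwa [pathPoint_cons] at this
  refine ⟨key p, fun h => ?_⟩
  refine percolatesBy_of_coinduction
    (fun p => [] ∈ openSet t p ∧ ∃ a ≤ (p.1 []).2, PercolatesBy t (shift [a] p)) ?_ h
  rintro p ⟨h1, a, ha, h2⟩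
  exact ⟨h1, a, ha, key _ h2⟩

lemma ReachesBy.of_succ {t : ℝ} {n : ℕ} {p : (Tree → Mark) × Set Tree}
    (h : ReachesBy t (n + 1) p) : ReachesBy t n p := by
  induction n generalizing p with
  | zero => trivial
  | succ n ih =>
    obtain ⟨h1, a, ha, h2⟩ := h
    exact ⟨h1, a, ha, ih h2⟩

lemma ReachesBy.of_le {t : ℝ} {m n : ℕ} (hmn : m ≤ n) {p : (Tree → Mark) × Set Tree}
    (h : ReachesBy t n p) : ReachesBy t m p := by
  induction n, hmn using Nat.le_induction with
  | base => exact h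
  | succ n _ ih => exact ih h.of_succ

/-- If each letter failed at some index, then by monotonicity both would fail at the smaller of the
two indices. This is the compactness of a finite choice. -/
lemma exists_le_of_forall_exists {ι : Type*} [LinearOrder ι] {b : Letter} {Q : ι → Letter → Prop}
    {T : Set ι} (hQ : ∀ m n, m ≤ n → ∀ a, Q m a → Q n a) (h : ∀ n ∈ T, ∃ a ≤ b, Q n a)
    (hT : T.Nonempty) : ∃ a ≤ b, ∀ n ∈ T, Q n a := by
  by_contra! hcon
  have : ∀ a : Letter, ∃ n ∈ T, a ≤ b → ¬ Q n a := by
    intro a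
    by_cases ha : a ≤ b
    · obtain ⟨n, hn, hna⟩ := hcon a ha
      exact ⟨n, hn, fun _ => hna⟩
    · exact ⟨hT.some, hT.some_mem, fun h => absurd h ha⟩
  choose N hN hNQ using this
  have hmem : min (N one) (N two) ∈ T := by
    rcases min_choice (N one) (N two) with h | h <;> rw [h] <;> exact hN _
  obtain ⟨a, hab, ha⟩ := h _ hmem
  have hle : min (N one) (N two) ≤ N a := by
    fin_cases a
    · exact min_le_left _ _
    · exact min_le_right _ _
  exact hNQ a hab (hQ _ _ hle a ha)

/-- König's lemma: having open paths of every length is inherited by some legal offspring. -/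
lemma percolatesBy_iff_forall_reachesBy {t : ℝ} {p : (Tree → Mark) × Set Tree} :
    PercolatesBy t p ↔ ∀ n, ReachesBy t n p := by
  constructor
  · intro h n
    induction n generalizing p with
    | zero => trivial
    | succ n ih =>
      obtain ⟨h1, a, ha, h2⟩ := percolatesBy_iff.1 h
      exact ⟨h1, a, ha, ih h2⟩
  · refine percolatesBy_of_coinduction (fun p => ∀ n, ReachesBy t n p) fun p hp => ⟨(hp 1).1, ?_⟩
    -- The order on `ℕ` is reversed because reaching `n` points gets harder as `n` grows.
    obtain ⟨a, ha, h⟩ := exists_le_of_forall_exists (ι := ℕᵒᵈ)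
      (Q := fun n a => ReachesBy t (OrderDual.ofDual n) (shift [a] p)) (b := (p.1 []).2)
      (T := univ) (fun m n h a => ReachesBy.of_le h) (fun n _ => (hp (OrderDual.ofDual n + 1)).2) ⟨OrderDual.toDual 0, trivial⟩
    exact ⟨a, ha, fun n => h (OrderDual.toDual n) trivial⟩

/-- The set of times at which the root percolates is closed under limits from the right. -/
lemma percolatesBy_of_forall {t : ℝ} {T : Set ℝ} (ht : ∀ ε > 0, ∃ s ∈ T, s < t + ε)
    {p : (Tree → Mark) × Set Tree} (hp : ∀ s ∈ T, PercolatesBy s p) : PercolatesBy t p := by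
  refine percolatesBy_of_coinduction (fun p => ∀ s ∈ T, PercolatesBy s p) (fun p hp => ?_) hp
  obtain ⟨s₀, hs₀, -⟩ := ht 1 one_pos
  refine ⟨?_, ?_⟩
  · rw [nil_mem_openSet]
    refine ⟨fun h1 => ?_, (nil_mem_openSet.1 (percolatesBy_iff.1 (hp s₀ hs₀)).1).2⟩
    refine le_of_forall_pos_lt_add fun ε hε => ?_
    obtain ⟨s, hs, hst⟩ := ht ε hε
    exact ((nil_mem_openSet.1 (percolatesBy_iff.1 (hp s hs)).1).1 h1).trans_lt hst
  · exact exists_le_of_forall_exists (Q := fun s a => PercolatesBy s (shift [a] p))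
      (fun m n h a => PercolatesBy.mono h) (fun s hs => (percolatesBy_iff.1 (hp s hs)).2)
      ⟨s₀, hs₀⟩

lemma measurable_shift (j : Tree) :
    Measurable (shift j : (Tree → Mark) × Set Tree → (Tree → Mark) × Set Tree) := by
  refine Measurable.prodMk (measurable_pi_lambda _ fun i => ?_) (measurable_set_iff.2 fun i => ?_)
  · exact (measurable_pi_apply _).comp measurable_fst
  · exact (measurable_set_mem (j ++ i)).comp measurable_snd

lemma measurableSet_nil_mem_openSet (t : ℝ) :
    MeasurableSet {p : (Tree → Mark) × Set Tree | [] ∈ openSet t p} := by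
  simp only [nil_mem_openSet]
  refine MeasurableSet.inter (MeasurableSet.imp ?_ ?_) ?_
  · exact (measurableSet_singleton one).preimage
      (by fun_prop : Measurable fun p : (Tree → Mark) × Set Tree => (p.1 []).2)
  · exact measurableSet_le (by fun_prop) measurable_const
  · exact (measurableSet_notMem []).preimage measurable_snd

lemma measurableSet_reachesBy (t : ℝ) (n : ℕ) : MeasurableSet {p | ReachesBy t n p} := by
  induction n with
  | zero => exact MeasurableSet.univ
  | succ n ih =>
    have : {p | ReachesBy t (n + 1) p} = {p : (Tree → Mark) × Set Tree | [] ∈ openSet t p} ∩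
        ⋃ a : Letter, {p | a ≤ (p.1 []).2} ∩ shift [a] ⁻¹' {p | ReachesBy t n p} := by
      ext p
      simp [ReachesBy]
    rw [this]
    refine (measurableSet_nil_mem_openSet t).inter (MeasurableSet.iUnion fun a => ?_)
    exact (measurableSet_le measurable_const (by fun_prop)).inter (measurable_shift _ ih)

lemma measurableSet_percolatesBy (t : ℝ) : MeasurableSet {p | PercolatesBy t p} := by
  simp only [percolatesBy_iff_forall_reachesBy, ofPred_forall]
  exact MeasurableSet.iInter fun n => measurableSet_reachesBy t n

/-! ### Laws invariant under `freezeStep` are the balanced laws -/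

lemma uniformOfFintype_letter_singleton (a : Letter) :
    (PMF.uniformOfFintype Letter).toMeasure {a} = 2⁻¹ := by
  rw [PMF.toMeasure_apply_singleton _ _ (measurableSet_singleton a)]
  simp

lemma markLaw_prod_singleton (s : Set unitInterval) (a : Letter) :
    markLaw (s ×ˢ {a}) = volume s * 2⁻¹ := by
  rw [markLaw, Measure.prod_prod, uniformOfFintype_letter_singleton]

lemma volume_coe_lt {y : ℝ} (hy : y ≤ 1) :
    volume {x : unitInterval | (x : ℝ) < y} = ENNReal.ofReal y := by
  rcases le_or_gt 0 y with h | h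
  · exact unitInterval.volume_Iio (x := ⟨y, h, hy⟩)
  · rw [ENNReal.ofReal_of_nonpos h.le]
    convert measure_empty (μ := (volume : Measure unitInterval))
    ext x
    simpa using h.le.trans x.2.1

lemma volume_coe_le {y : ℝ} (h0 : 0 ≤ y) (h1 : y ≤ 1) :
    volume {x : unitInterval | (x : ℝ) ≤ y} = ENNReal.ofReal y :=
  unitInterval.volume_Iic (x := ⟨y, h0, h1⟩)

lemma eq_one_or_eq_two (a : Letter) : a = one ∨ a = two := by
  fin_cases a <;> simp

lemma one_ne_two : one ≠ two := by decide

/-- The union of the rectangles `D × Q` and `Q × D`, where `D ⊆ Q`. -/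
lemma prod_union_prod_add {α : Type*} [MeasurableSpace α] (μ : Measure α) [SFinite μ]
    {D Q : Set α} (hD : MeasurableSet D) (hQ : MeasurableSet Q) (hDQ : D ⊆ Q) :
    (μ.prod μ) (D ×ˢ Q ∪ Q ×ˢ D) + μ D ^ 2 = 2 * (μ D * μ Q) := by
  have h : D ×ˢ Q ∩ Q ×ˢ D = D ×ˢ D := by
    rw [prod_inter_prod, inter_eq_left.2 hDQ, inter_eq_right.2 hDQ]
  have := measure_union_add_inter (μ := μ.prod μ) (D ×ˢ Q) (hQ.prod hD)
  rw [h, Measure.prod_prod, Measure.prod_prod, Measure.prod_prod] at this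
  rw [sq, this]
  ring

lemma markLaw_prod_apply_two {α : Type*} [MeasurableSpace α] (ρ : Measure α) [SFinite ρ]
    {D Q : Set α} (hD : MeasurableSet D) (hQ : MeasurableSet Q) (hDQ : D ⊆ Q) :
    2 * (markLaw.prod (ρ.prod ρ)) ((univ ×ˢ {two}) ×ˢ (D ×ˢ Q ∪ Q ×ˢ D)) + ρ D ^ 2 =
      2 * (ρ D * ρ Q) := by
  rw [Measure.prod_prod, markLaw_prod_singleton, measure_univ, one_mul, ← mul_assoc,
    ENNReal.mul_inv_cancel (by simp) (by simp), one_mul, prod_union_prod_add ρ hD hQ hDQ]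

/-- For `y ≤ 1` the probability of `τ < y` is `y`, apart from sign; `t < 2` keeps the atom at 2 out
of play. The factor 2 cancels the probability of `κ = 1`. -/
lemma markLaw_prod_apply_one_lt (ρ : Measure ℝ) [IsProbabilityMeasure ρ] {t : ℝ} (ht : t < 2)
    (hρ : ∀ᵐ y ∂ρ, y ≤ 1 ∨ y = 2) :
    2 * (markLaw.prod (ρ.prod ρ)) {p | p.1.2 = one ∧ (p.1.1 : ℝ) < p.2.1 ∧ p.2.1 ≤ t} =
      ∫⁻ y in Iic t, ENNReal.ofReal y ∂ρ := by
  set V : Set (unitInterval × ℝ) := {q | (q.1 : ℝ) < q.2 ∧ q.2 ≤ t} with hV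
  have hVm : MeasurableSet V :=
    (measurableSet_lt (measurable_subtype_coe.comp measurable_fst) measurable_snd).inter
      (measurableSet_le measurable_snd measurable_const)
  have hcomm := measurePreserving_prodProdProdComm (volume : Measure unitInterval)
    (PMF.uniformOfFintype Letter).toMeasure ρ ρ
  have hset : {p : Mark × ℝ × ℝ | p.1.2 = one ∧ (p.1.1 : ℝ) < p.2.1 ∧ p.2.1 ≤ t} =
      (fun p : Mark × ℝ × ℝ => ((p.1.1, p.2.1), (p.1.2, p.2.2))) ⁻¹' (V ×ˢ ({one} ×ˢ univ)) := by
    ext p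
    simp [hV]
    tauto
  rw [hset, markLaw, hcomm.measure_preimage
    (hVm.prod ((measurableSet_singleton _).prod MeasurableSet.univ)).nullMeasurableSet,
    Measure.prod_prod, Measure.prod_prod, uniformOfFintype_letter_singleton, measure_univ, mul_one,
    mul_comm _ (2⁻¹), ← mul_assoc, ENNReal.mul_inv_cancel (by simp) (by simp), one_mul,
    Measure.prod_apply_symm hVm, ← lintegral_indicator measurableSet_Iic]
  refine lintegral_congr_ae ?_
  filter_upwards [hρ] with y hy
  by_cases hyt : y ≤ t
  · have hy1 : y ≤ 1 := hy.resolve_right (by linarith)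
    rw [indicator_of_mem (mem_Iic.2 hyt), ← volume_coe_lt hy1]
    congr 1
    ext x
    simp [hV, hyt]
  · rw [indicator_of_notMem (by simpa using hyt)]
    convert measure_empty (μ := (volume : Measure unitInterval))
    ext x
    simp [hV, hyt]

/-- The root time is at most `t` if `κ = 1` and `τ < y ≤ t`, or if `κ = 2` and one of the two
offspring times is at most `t`; the latter has probability `(2G - G²)/2`. For an invariant law the
terms `2G` cancel and balance remains. -/
lemma two_mul_map_freezeStep_Iic_add (ρ : Measure ℝ) [IsProbabilityMeasure ρ] {t : ℝ} (ht : t < 2)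
    (hρ : ∀ᵐ y ∂ρ, y ≤ 1 ∨ y = 2) :
    2 * (markLaw.prod (ρ.prod ρ)).map freezeStep (Iic t) + ρ (Iic t) ^ 2 =
      2 * ρ (Iic t) + ∫⁻ y in Iic t, ENNReal.ofReal y ∂ρ := by
  have hset : freezeStep ⁻¹' Iic t =
      {p : Mark × ℝ × ℝ | p.1.2 = one ∧ (p.1.1 : ℝ) < p.2.1 ∧ p.2.1 ≤ t} ∪
        (univ ×ˢ {two}) ×ˢ (Iic t ×ˢ univ ∪ univ ×ˢ Iic t) := by
    ext ⟨⟨x, a⟩, y, y'⟩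
    rcases eq_one_or_eq_two a with rfl | rfl
    · by_cases hy : y ≤ x
      · simp [freezeStep, hy, not_le.2 ht, not_lt.2 hy]
      · simp [freezeStep, hy, not_le.1 hy]
    · simp [freezeStep]
  have hdisj : Disjoint {p : Mark × ℝ × ℝ | p.1.2 = one ∧ (p.1.1 : ℝ) < p.2.1 ∧ p.2.1 ≤ t}
      ((univ ×ˢ {two}) ×ˢ (Iic t ×ˢ univ ∪ univ ×ˢ Iic t)) := by
    rw [Set.disjoint_left]
    rintro p ⟨h, -⟩ ⟨⟨-, h'⟩, -⟩
    rw [mem_singleton_iff] at h'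
    exact one_ne_two (h.symm.trans h')
  have hm : MeasurableSet ((univ ×ˢ {two} : Set Mark) ×ˢ
      (Iic t ×ˢ univ ∪ univ ×ˢ Iic t : Set (ℝ × ℝ))) :=
    (MeasurableSet.univ.prod (measurableSet_singleton _)).prod
      ((measurableSet_Iic.prod MeasurableSet.univ).union
        (MeasurableSet.univ.prod measurableSet_Iic))
  have h2 := markLaw_prod_apply_two ρ (measurableSet_Iic (a := t)) MeasurableSet.univ (subset_univ _)
  rw [measure_univ, mul_one] at h2
  rw [Measure.map_apply measurable_freezeStep measurableSet_Iic, hset, measure_union hdisj hm,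
    mul_add, add_assoc, h2, markLaw_prod_apply_one_lt ρ ht hρ, add_comm]

lemma isBalanced_of_map_freezeStep {ρ : Measure ℝ} [IsProbabilityMeasure ρ]
    (hρ : ∀ᵐ y ∂ρ, y ≤ 1 ∨ y = 2) (h : (markLaw.prod (ρ.prod ρ)).map freezeStep = ρ) :
    IsBalanced ρ := by
  intro t ht
  have := two_mul_map_freezeStep_Iic_add ρ ht hρ
  rw [h] at this
  exact (ENNReal.add_right_inj (by finiteness)).1 this

lemma IsBalanced.map_freezeStep {ρ : Measure ℝ} [IsProbabilityMeasure ρ] (hb : IsBalanced ρ)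
    (hρ : ∀ᵐ y ∂ρ, y ≤ 1 ∨ y = 2) : (markLaw.prod (ρ.prod ρ)).map freezeStep = ρ := by
  have : IsProbabilityMeasure ((markLaw.prod (ρ.prod ρ)).map freezeStep) :=
    Measure.isProbabilityMeasure_map (by fun_prop)
  refine Measure.ext_of_Iic _ _ fun t => ?_
  rcases lt_or_ge t 2 with ht | ht
  · have := two_mul_map_freezeStep_Iic_add ρ ht hρ
    rw [hb t ht] at this
    have := (ENNReal.add_left_inj (by rw [← hb t ht]; finiteness)).1 this
    exact (ENNReal.mul_right_inj (by simp) (by simp)).1 this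
  · have h1 : ∀ᵐ y ∂ρ, y ≤ 2 := by
      filter_upwards [hρ] with y hy
      rcases hy with h | h <;> linarith
    have e1 : ∀ᵐ y ∂ρ, y ∈ Iic t := h1.mono fun y hy => hy.trans ht
    have h2 : ∀ᵐ p ∂markLaw.prod (ρ.prod ρ), p.2.1 ≤ 2 := 
      (measurePreserving_fst.comp measurePreserving_snd).quasiMeasurePreserving.ae h1
    have e2 : ∀ᵐ y ∂(markLaw.prod (ρ.prod ρ)).map freezeStep, y ∈ Iic t := by
      refine (ae_map_iff (by fun_prop) measurableSet_Iic).2 ?_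
      filter_upwards [h2] with p hp
      refine le_trans ?_ ht
      unfold freezeStep
      split_ifs
      · exact le_rfl
      · exact hp
      · exact (min_le_left _ _).trans hp
    rw [prob_compl_eq_zero_iff measurableSet_Iic |>.1 e1,
      prob_compl_eq_zero_iff measurableSet_Iic |>.1 e2]

lemma IsRTP.map_freezeStep {μ : Measure MTree} (hμ : IsRTP μ) :
    (markLaw.prod ((μ.map rootTime).prod (μ.map rootTime))).map freezeStep = μ.map rootTime := by
  have := hμ.prob
  have hr : MeasurePreserving rootTime μ (μ.map rootTime) := ⟨measurable_rootTime, rfl⟩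
  have h := ((MeasurePreserving.id markLaw).prod (hr.prod hr)).comp hμ.measurePreserving
  rw [← h.map_eq, Measure.map_map (by fun_prop) h.measurable]
  exact Measure.map_congr (hμ.step.mono fun z hz => hz.symm)

/-! ### The lower bound `t ≤ 2G(t)` and percolation after the root time -/

/-- The random variables `(Ω, 𝔽)` as a function of the marks and the percolation times. -/
def toPair (z : MTree) : (Tree → Mark) × Set Tree :=
  (fun i => (z i).1, {i | (z i).1.2 = one ∧ (z (i ++ [one])).2 ≤ (z i).1.1})

lemma toPair_branch (a : Letter) (z : MTree) : toPair (branch a z) = shift [a] (toPair z) := rfl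

lemma measurable_toPair : Measurable toPair := by
  refine Measurable.prodMk (by fun_prop) (measurable_set_iff.2 fun i => ?_)
  refine Measurable.and ?_ ?_
  · exact measurableSet_setOfPred.1 ((measurableSet_singleton one).preimage
      (by fun_prop : Measurable fun z : MTree => (z i).1.2))
  · exact measurableSet_setOfPred.1 (measurableSet_le (by fun_prop) (by fun_prop))

/-- The event that the root is open at time `t` and that a legal offspring has a given property,
intersected with the event that the root does not percolate by time `t`. -/
lemma IsRTP.measureReal_open_inter {μ : Measure MTree} (hμ : IsRTP μ) {t : ℝ} (h0 : 0 ≤ t)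
    (h1 : t ≤ 1) {C : Set ((Tree → Mark) × Set Tree)} (hC : MeasurableSet C) :
    μ.real {z | ([] ∈ openSet t (toPair z) ∧ ∃ a ≤ (z []).1.2, shift [a] (toPair z) ∈ C) ∧
        t < rootTime z} =
      μ.real {z | toPair z ∈ C ∧ t < rootTime z} *
        (t / 2 + μ.real {z | t < rootTime z} - μ.real {z | toPair z ∈ C ∧ t < rootTime z} / 2) := by
  have := hμ.prob
  set Q : Set MTree := {z | t < rootTime z} with hQ
  set D : Set MTree := {z | toPair z ∈ C ∧ t < rootTime z} with hD
  have hQm : MeasurableSet Q := measurableSet_lt measurable_const measurable_rootTime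
  have hDm : MeasurableSet D := (measurable_toPair hC).inter hQm
  -- With `κ = 1` the second branch is irrelevant, and the root is unfrozen automatically since `τ ≤
  -- t < Y_1`. With `κ = 2` both offspring times exceed `t` and at least one branch lies in `D`.
  set S₁ : Set (Mark × MTree × MTree) := ({x : unitInterval | (x : ℝ) ≤ t} ×ˢ {one}) ×ˢ (D ×ˢ univ) with hS₁
  set S₂ : Set (Mark × MTree × MTree) := (univ ×ˢ {two}) ×ˢ (D ×ˢ Q ∪ Q ×ˢ D) with hS₂
  have hS₁m : MeasurableSet S₁ :=
    ((measurableSet_le measurable_subtype_coe measurable_const).prod (measurableSet_singleton _)).prod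
      (hDm.prod MeasurableSet.univ)
  have hS₂m : MeasurableSet S₂ := (MeasurableSet.univ.prod (measurableSet_singleton _)).prod
      ((hDm.prod hQm).union (hQm.prod hDm))
  have hdisj : Disjoint S₁ S₂ := by
    rw [Set.disjoint_left]
    rintro p ⟨⟨-, h⟩, -⟩ ⟨⟨-, h'⟩, -⟩
    rw [mem_singleton_iff] at h h'
    exact one_ne_two (h.symm.trans h')
  have hae : {z | ([] ∈ openSet t (toPair z) ∧ ∃ a ≤ (z []).1.2, shift [a] (toPair z) ∈ C) ∧
      t < rootTime z} =ᵐ[μ] decompose ⁻¹' (S₁ ∪ S₂) := by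
    filter_upwards [hμ.step] with z hz
    refine propext ?_
    change (_ ∧ _) ↔ decompose z ∈ S₁ ∪ S₂
    have hnil : [] ∈ (toPair z).2 ↔ (z []).1.2 = one ∧ rootTime (branch one z) ≤ (z []).1.1 :=
      Iff.rfl
    have e1 : (toPair z).1 [] = (z []).1 := rfl
    rw [hz, nil_mem_openSet, hnil, e1]
    simp only [← toPair_branch, decompose, hS₁, hS₂, mem_union, mem_prod, mem_univ, true_and,
      mem_singleton_iff, hD, hQ, mem_ofPred_eq, and_true, freezeStep]
    rcases eq_one_or_eq_two (z []).1.2 with hk | hk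
    · have hle : ∀ a : Letter, a ≤ one ↔ a = one := by decide
      simp only [hk, hle, true_and, if_true, exists_eq_left, one_ne_two, false_and, or_false,
        forall_true_left, not_le]
      constructor
      · rintro ⟨⟨⟨h1, h2⟩, h3⟩, h4⟩
        rw [if_neg (not_le.2 h2)] at h4
        exact ⟨⟨h1, trivial⟩, h3, h4⟩
      · rintro ⟨⟨h1, -⟩, h3, h4⟩
        rw [if_neg (not_le.2 (h1.trans_lt h4))]
        exact ⟨⟨⟨h1, h1.trans_lt h4⟩, h3⟩, h4⟩
    · have hle : ∀ a : Letter, a ≤ two := by decide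
      have hex : ∀ P : Letter → Prop, (∃ a, P a) ↔ P one ∨ P two := fun P =>
        ⟨fun ⟨a, ha⟩ => by rcases eq_one_or_eq_two a with rfl | rfl <;> simp [ha], fun h => by
          rcases h with h | h <;> exact ⟨_, h⟩⟩
      simp only [hk, hle, true_and, one_ne_two.symm, false_and, not_false_eq_true, and_true,
        if_false, hex, lt_min_iff, and_false, false_or, false_imp_iff]
      tauto
  have m₁ : μ.real (decompose ⁻¹' S₁) = μ.real D * (t / 2) := by
    rw [Measure.real, hμ.measurePreserving.measure_preimage hS₁m.nullMeasurableSet, hS₁,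
      Measure.prod_prod, Measure.prod_prod, markLaw_prod_singleton, volume_coe_le h0 h1, measure_univ,
      mul_one]
    simp [ENNReal.toReal_mul, ENNReal.toReal_ofReal h0, Measure.real]
    ring
  have m₂ : 2 * μ.real (decompose ⁻¹' S₂) + μ.real D ^ 2 = 2 * (μ.real D * μ.real Q) := by
    have h := markLaw_prod_apply_two μ hDm hQm (fun z hz => hz.2 : D ⊆ Q)
    rw [← hS₂, ← hμ.measurePreserving.measure_preimage hS₂m.nullMeasurableSet] at h
    have h' := congrArg ENNReal.toReal h
    rw [ENNReal.toReal_add (by finiteness) (by finiteness)] at h'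
    simpa [Measure.real] using h'
  rw [measureReal_congr hae, preimage_union,
    measureReal_union (hdisj.preimage _) (measurable_decompose hS₂m), m₁]
  linarith

section LowerBound

variable {μ : Measure MTree} {t : ℝ}

lemma measureReal_lt_rootTime [IsProbabilityMeasure μ] :
    μ.real {z | t < rootTime z} = 1 - (μ.map rootTime).real (Iic t) := by
  have h : {z | t < rootTime z} = (rootTime ⁻¹' Iic t)ᶜ := by
    ext z
    simp
  rw [h, probReal_compl_eq_one_sub (measurable_rootTime measurableSet_Iic),
    map_measureReal_apply measurable_rootTime measurableSet_Iic]

/-- A point whose percolation time is larger than `t` cannot percolate at time `t`, provided the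
law of the percolation time satisfies the lower bound. -/
lemma IsRTP.ae_not_percolatesBy (hμ : IsRTP μ) (h0 : 0 ≤ t) (h1 : t ≤ 1)
    (hlow : t ≤ 2 * (μ.map rootTime).real (Iic t)) :
    ∀ᵐ z ∂μ, PercolatesBy t (toPair z) → rootTime z ≤ t := by
  have := hμ.prob
  have h := hμ.measureReal_open_inter h0 h1 (measurableSet_percolatesBy t)
  simp only [mem_ofPred_eq] at h
  have he : {z | ([] ∈ openSet t (toPair z) ∧
      ∃ a ≤ (z []).1.2, PercolatesBy t (shift [a] (toPair z))) ∧ t < rootTime z} =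
      {z | PercolatesBy t (toPair z) ∧ t < rootTime z} := by
    ext z
    rw [mem_ofPred_eq, mem_ofPred_eq, percolatesBy_iff (p := toPair z)]
    rfl
  rw [he, measureReal_lt_rootTime] at h
  set p := μ.real {z | PercolatesBy t (toPair z) ∧ t < rootTime z} with hp
  have hp0 : 0 ≤ p := measureReal_nonneg
  -- The recursion is `p = p (1 + (t - 2G)/2 - p/2)`, so `p = 0` or `p = t - 2G ≤ 0`.
  have hz : p = 0 := by nlinarith
  have : ∀ᵐ z ∂μ, z ∉ {z | PercolatesBy t (toPair z) ∧ t < rootTime z} :=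
    measure_eq_zero_iff_ae_notMem.1 ((measureReal_eq_zero_iff).1 hz)
  filter_upwards [this] with z hz hperc
  by_contra hcon
  exact hz ⟨hperc, not_le.1 hcon⟩

/-- If a point whose percolation time is larger than `t` cannot percolate at time `t`, then the law
of the percolation time satisfies the lower bound. -/
lemma IsRTP.le_two_mul (hμ : IsRTP μ) (h0 : 0 ≤ t) (h1 : t ≤ 1)
    (h : ∀ᵐ z ∂μ, PercolatesBy t (toPair z) → rootTime z ≤ t) :
    t ≤ 2 * (μ.map rootTime).real (Iic t) := by
  have := hμ.prob
  let E : ℕ → Set MTree := fun n => {z | ReachesBy t n (toPair z) ∧ t < rootTime z}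
  have hEm : ∀ n, MeasurableSet (E n) := fun n =>
    (measurable_toPair (measurableSet_reachesBy t n)).inter
      (measurableSet_lt measurable_const measurable_rootTime)
  have hanti : Antitone E := fun m n hmn z hz => ⟨ReachesBy.of_le hmn hz.1, hz.2⟩
  have hlim : Tendsto (fun n => μ.real (E n)) atTop (𝓝 0) := by
    have h2 : μ (⋂ n, E n) = 0 := by
      rw [measure_eq_zero_iff_ae_notMem]
      filter_upwards [h] with z hz hzE
      have hzE' : ∀ n, z ∈ E n := mem_iInter.1 hzE
      exact absurd (hz (percolatesBy_iff_forall_reachesBy.2 fun n => (hzE' n).1))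
        (not_le.2 (hzE' 0).2)
    have h3 := tendsto_measure_iInter_atTop (μ := μ) (fun n => (hEm n).nullMeasurableSet) hanti
      ⟨0, measure_ne_top _ _⟩
    rw [h2] at h3
    exact (ENNReal.tendsto_toReal (by simp)).comp h3
  set G := (μ.map rootTime).real (Iic t) with hG
  have hG0 : 0 ≤ G := measureReal_nonneg
  by_contra! hcon
  -- With `c = t - 2G` and `p_n` the measure of `E n`, the recursion reads `p_{n+1} - c = (p_n -
  -- c)(1 - p_n/2)`. Hence `p_n ≥ c` persists from `p_0 = 1 - G ≥ c`, and `p_n → 0` contradicts `c >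
  -- 0`.
  have hge : ∀ n, t - 2 * G ≤ μ.real (E n) := by
    intro n
    induction n with
    | zero =>
      have : E 0 = {z | t < rootTime z} := by
        ext z
        simp [E, ReachesBy]
      rw [this, measureReal_lt_rootTime]
      linarith
    | succ n ih =>
      have hs := hμ.measureReal_open_inter h0 h1 (measurableSet_reachesBy t n)
      rw [measureReal_lt_rootTime, ← hG] at hs
      have hs' : μ.real (E (n + 1)) = μ.real (E n) * (t / 2 + (1 - G) - μ.real (E n) / 2) := hs
      have h4 : μ.real (E n) ≤ 1 := measureReal_le_one
      rw [hs']
      nlinarith [mul_nonneg (sub_nonneg.2 ih) (by linarith : 0 ≤ 1 - μ.real (E n) / 2)]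
  have := ge_of_tendsto' hlim hge
  linarith

end LowerBound

/-! ### The constructed process solves the frozen percolation equation -/

section Subtree

variable {X : Type*}

/-- The labelled tree above the point `i`. -/
def subtree (i : Tree) (z : Tree → X) : Tree → X := fun j => z (i ++ j)

lemma subtree_subtree (i j : Tree) (z : Tree → X) : subtree j (subtree i z) = subtree (i ++ j) z := by
  funext l
  simp [subtree]

@[fun_prop]
lemma measurable_subtree [MeasurableSpace X] (i : Tree) :
    Measurable (subtree i : (Tree → X) → Tree → X) :=
  measurable_pi_lambda _ fun _ => measurable_pi_apply _

end Subtree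

lemma toPair_subtree (i : Tree) (z : MTree) : toPair (subtree i z) = shift i (toPair z) := by
  simp [toPair, subtree, shift]

lemma IsRTP.measurePreserving_subtree {μ : Measure MTree} (hμ : IsRTP μ) (i : Tree) :
    MeasurePreserving (subtree i) μ μ := by
  have := hμ.prob
  induction i with
  | nil => exact MeasurePreserving.id μ
  | cons a i ih =>
    have hb : MeasurePreserving (branch a) μ μ := by
      rcases eq_one_or_eq_two a with rfl | rfl
      · exact measurePreserving_fst.comp (measurePreserving_snd.comp hμ.measurePreserving)
      · exact measurePreserving_snd.comp (measurePreserving_snd.comp hμ.measurePreserving)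
    exact ih.comp hb

/-- A countable dense subset can miss points that are isolated in `Ξ` from the right, but there are
only countably many of these. This reduces statements about all times in `Ξ` to countably many null
sets. -/
lemma exists_countable_right_dense (Ξ : Set ℝ) :
    ∃ C ⊆ Ξ, C.Countable ∧ ∀ t ∈ Ξ, ∀ y > t, ∃ s ∈ C, t ≤ s ∧ s < y := by
  obtain ⟨D, hD, hDc, hDd⟩ :=
    (TopologicalSpace.IsSeparable.of_separableSpace Ξ).exists_countable_dense_subset
  refine ⟨D ∪ {x ∈ Ξ | 𝓝[Ξ ∩ Ioi x] x = ⊥}, union_subset hD (sep_subset _ _),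
    hDc.union countable_setOfPred_isolated_right_within, fun t ht y hy => ?_⟩
  by_cases hbot : 𝓝[Ξ ∩ Ioi t] t = ⊥
  · exact ⟨t, Or.inr ⟨ht, hbot⟩, le_rfl, hy⟩
  · have : (𝓝[Ξ ∩ Ioi t] t).NeBot := ⟨hbot⟩
    have h1 : ∀ᶠ x in 𝓝[Ξ ∩ Ioi t] t, x ∈ Ξ ∩ Ioi t := self_mem_nhdsWithin
    have h2 : ∀ᶠ x in 𝓝[Ξ ∩ Ioi t] t, x < y := nhdsWithin_le_nhds (gt_mem_nhds hy)
    obtain ⟨x, hx, hxy⟩ := (h1.and h2).exists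
    obtain ⟨s, hs, hsD⟩ := mem_closure_iff.1 (hDd hx.1) (Ioo t y) isOpen_Ioo ⟨hx.2, hxy⟩
    exact ⟨s, Or.inl hsD, hs.1.le, hs.2⟩

/-- A point percolates at any time that is at least its percolation time. -/
lemma percolatesBy_of_rootTime_le {z : MTree} {t : ℝ} (ht : t < 2)
    (hstep : ∀ i, rootTime (subtree i z) = freezeStep ((z i).1, rootTime (subtree (i ++ [one]) z),
      rootTime (subtree (i ++ [two]) z))) {i : Tree} (hi : rootTime (subtree i z) ≤ t) :
    PercolatesBy t (shift i (toPair z)) := by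
  refine percolatesBy_of_coinduction
    (fun p => ∃ i, p = shift i (toPair z) ∧ rootTime (subtree i z) ≤ t) ?_ ⟨i, rfl, hi⟩
  rintro p ⟨i, rfl, hi⟩
  have hnil : [] ∈ (shift i (toPair z)).2 ↔
      (z i).1.2 = one ∧ rootTime (subtree (i ++ [one]) z) ≤ (z i).1.1 := by
    simp [shift, toPair, subtree, rootTime]
  have hmark : (shift i (toPair z)).1 [] = (z i).1 := by
    simp [shift, toPair]
  rw [nil_mem_openSet, hnil, hmark]
  rw [hstep i] at hi
  rcases eq_one_or_eq_two (z i).1.2 with hk | hk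
  · simp only [freezeStep, hk, if_true] at hi
    split_ifs at hi with h
    · linarith
    · refine ⟨⟨fun _ => (not_le.1 h).le.trans hi, fun h' => h h'.2⟩, one, ?_, i ++ [one], ?_, hi⟩
      · rw [hk]
      · rw [shift_shift]
  · simp only [freezeStep, hk, one_ne_two.symm, if_false, min_le_iff] at hi
    rw [hk]
    refine ⟨⟨fun h => absurd h.symm one_ne_two, fun h => one_ne_two h.1.symm⟩, ?_⟩
    rcases hi with hi | hi
    · exact ⟨one, by decide, i ++ [one], by rw [shift_shift], hi⟩
    · exact ⟨two, le_rfl, i ++ [two], by rw [shift_shift], hi⟩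

/-- If `Y_{i1} ≤ τ_i ≤ 1`, then `Y_{i1}` is not 2 and is itself an admissible time in `Ξ` at which
`i1` percolates. The converse is `hperc`. -/
lemma solvesFrozen_toPair {Ξ : Set (Ioc (0 : ℝ) 1)} {z : MTree}
    (hsupp : ∀ i, rootTime (subtree i z) ∈ Subtype.val '' Ξ ∪ {2})
    (hstep : ∀ i, rootTime (subtree i z) = freezeStep ((z i).1, rootTime (subtree (i ++ [one]) z),
      rootTime (subtree (i ++ [two]) z)))
    (hperc : ∀ i, ∀ t ∈ Ξ, PercolatesBy t (shift i (toPair z)) → rootTime (subtree i z) ≤ t) :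
    SolvesFrozen Ξ (toPair z).1 (toPair z).2 := by
  intro i
  have hmem : i ∈ (toPair z).2 ↔
      (z i).1.2 = one ∧ rootTime (subtree (i ++ [one]) z) ≤ (z i).1.1 := by
    simp [toPair, subtree, rootTime]
  rw [hmem]
  refine and_congr_right fun _ => ⟨fun h => ?_, ?_⟩
  · have h1 : ((z i).1.1 : ℝ) ≤ 1 := (z i).1.1.2.2
    obtain ⟨t, ht, htv⟩ : rootTime (subtree (i ++ [one]) z) ∈ Subtype.val '' Ξ := by
      refine (hsupp (i ++ [one])).resolve_right fun h2 => ?_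
      rw [mem_singleton_iff] at h2
      linarith
    refine ⟨t, ht, htv.trans_le h, ?_⟩
    exact (percolatesBy_shift _ _ _).1 (percolatesBy_of_rootTime_le
      (by rw [htv]; linarith) hstep htv.ge)
  · rintro ⟨t, ht, hle, h⟩
    exact (hperc _ t ht ((percolatesBy_shift _ _ _).2 h)).trans hle

lemma IsRTP.ae_solvesFrozen {Ξ : Set (Ioc (0 : ℝ) 1)} {μ : Measure MTree} (hμ : IsRTP μ)
    (hρ : IsFreezingLaw (Subtype.val '' Ξ) (μ.map rootTime)) :
    ∀ᵐ z ∂μ, SolvesFrozen Ξ (toPair z).1 (toPair z).2 := by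
  have := hμ.prob
  obtain ⟨C, hCΞ, hC, hdense⟩ := exists_countable_right_dense (Subtype.val '' Ξ)
  have h1 : ∀ᵐ z ∂μ, rootTime z ∈ Subtype.val '' Ξ ∪ {2} :=
    ae_of_ae_map measurable_rootTime.aemeasurable hρ.support
  have h3 : ∀ᵐ z ∂μ, ∀ t ∈ C, PercolatesBy t (toPair z) → rootTime z ≤ t := by
    rw [ae_ball_iff hC]
    intro t ht
    obtain ⟨s, hs, rfl⟩ := hCΞ ht
    refine hμ.ae_not_percolatesBy s.2.1.le s.2.2 ?_
    have := ENNReal.toReal_mono (by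
      have := hρ.prob
      finiteness) (hρ.lower s (hCΞ ht))
    simpa [ENNReal.toReal_ofReal s.2.1.le, Measure.real] using this
  have hall : ∀ {q : MTree → Prop}, (∀ᵐ z ∂μ, q z) → ∀ᵐ z ∂μ, ∀ i, q (subtree i z) := fun hq =>
    ae_all_iff.2 fun i => (hμ.measurePreserving_subtree i).quasiMeasurePreserving.ae hq
  filter_upwards [hall h1, hall hμ.step, hall h3] with z hz1 hz2 hz3
  refine solvesFrozen_toPair hz1 (fun i => ?_) fun i t ht hp => ?_
  · have := hz2 i
    have h0 : subtree i z [] = z i := by simp [subtree]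
    rw [h0] at this
    rw [← subtree_subtree, ← subtree_subtree]
    exact this
  -- A violation at time `t` persists until the recursive time of the point, hence occurs at a time
  -- of the countable set `C`.
  · by_contra! hlt
    obtain ⟨s, hs, hts, hsY⟩ := hdense t ⟨t, ht, rfl⟩ _ hlt
    rw [← toPair_subtree] at hp
    exact absurd (hz3 i s hs (hp.mono hts)) (not_le.2 hsY)

/-! ### Independence along finite rooted subtrees -/

/-- Two families of random variables are independent of each other if events that are determined
by boxes are. -/
lemma indepFun_of_boxes {Ω ι κ : Type*} [Finite ι] [Finite κ] [MeasurableSpace Ω] {P : Measure Ω}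
    [IsProbabilityMeasure P] {α : ι → Type*} {β : κ → Type*} [∀ i, MeasurableSpace (α i)]
    [∀ j, MeasurableSpace (β j)] {X : ∀ i, Ω → α i} {Y : ∀ j, Ω → β j}
    (hX : ∀ i, Measurable (X i)) (hY : ∀ j, Measurable (Y j))
    (h : ∀ (A : ∀ i, Set (α i)) (B : ∀ j, Set (β j)), (∀ i, MeasurableSet (A i)) →
      (∀ j, MeasurableSet (B j)) →
      P ({s | ∀ i, X i s ∈ A i} ∩ {s | ∀ j, Y j s ∈ B j}) =
        P {s | ∀ i, X i s ∈ A i} * P {s | ∀ j, Y j s ∈ B j}) :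
    IndepFun (fun s i => X i s) (fun s j => Y j s) P := by
  rw [IndepFun_iff_Indep]
  refine IndepSets.indep (measurable_pi_lambda _ hX).comap_le (measurable_pi_lambda _ hY).comap_le
    ((isPiSystem_pi (α := α)).comap fun s i => X i s)
    ((isPiSystem_pi (α := β)).comap fun s j => Y j s) ?_ ?_ ?_
  · rw [← generateFrom_pi, MeasurableSpace.comap_generateFrom]
    rfl
  · rw [← generateFrom_pi, MeasurableSpace.comap_generateFrom]
    rfl
  · rw [IndepSets_iff]
    rintro _ _ ⟨_, ⟨A, hA, rfl⟩, rfl⟩ ⟨_, ⟨B, hB, rfl⟩, rfl⟩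
    convert h A B (fun i => hA i trivial) (fun j => hB j trivial) using 2
    · simp [Set.pi, preimage]
    · congr 1
      simp [Set.pi, preimage]
    · congr 1
      simp [Set.pi, preimage]

lemma boundary_empty : boundary ∅ = {[]} := by
  ext i
  simp [boundary]

lemma boundary_insert {U : Set Tree} (hU : IsRootedSubtree U) {j : Tree} (hj : j ∈ boundary U) :
    boundary (insert j U) = insert (j ++ [one]) (insert (j ++ [two]) (boundary U \ {j})) := by
  have hjU : j ∉ U := by
    rcases hj with ⟨rfl, -⟩ | ⟨h, -⟩
    · simp
    · exact h
  have hparent : ∀ i : Tree, i ≠ [] ∧ i.dropLast = j ↔ i = j ++ [one] ∨ i = j ++ [two] := by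
    intro i
    constructor
    · rintro ⟨hi, rfl⟩
      rcases eq_one_or_eq_two (i.getLast hi) with h | h
      · exact Or.inl (by rw [← h, List.dropLast_append_getLast])
      · exact Or.inr (by rw [← h, List.dropLast_append_getLast])
    · rintro (rfl | rfl) <;> simp
  have hchild : ∀ a : Letter, j ++ [a] ∉ U := fun a h => hjU (by simpa using hU _ h (by simp))
  ext i
  simp only [mem_insert_iff, mem_sdiff_singleton]
  constructor
  · rintro (⟨h, -⟩ | ⟨h1, h2, h3⟩)
    · exact absurd h (insert_nonempty _ _).ne_empty
    · rw [mem_insert_iff, not_or] at h1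
      rcases h3 with h3 | h3
      · rcases (hparent i).1 ⟨h2, h3⟩ with h | h
        · exact Or.inl h
        · exact Or.inr (Or.inl h)
      · exact Or.inr (Or.inr ⟨Or.inr ⟨h1.2, h2, h3⟩, h1.1⟩)
  · have hc : ∀ a : Letter, j ++ [a] ∈ boundary (insert j U) := fun a =>
      Or.inr ⟨by simpa using hchild a, by simp, by simp⟩
    rintro (rfl | rfl | ⟨⟨rfl, rfl⟩ | ⟨h1, h2, h3⟩, h⟩)
    · exact hc one
    · exact hc two
    · rw [boundary_empty, mem_singleton_iff] at hj
      exact absurd hj.symm h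
    · exact Or.inr ⟨by simp [h, h1], h2, Or.inr h3⟩

/-- Finite rooted subtrees are built up by successively adding boundary points. -/
lemma rootedSubtree_induction {C : Set Tree → Prop} (hempty : C ∅)
    (hinsert : ∀ U j, U.Finite → IsRootedSubtree U → j ∈ boundary U → C U → C (insert j U))
    {U : Set Tree} (hfin : U.Finite) (hU : IsRootedSubtree U) : C U := by
  induction hn : U.ncard generalizing U with
  | zero =>
    rw [Set.ncard_eq_zero hfin] at hn
    rwa [hn]
  | succ n ih =>
    have hne : U.Nonempty := by
      rw [← Set.ncard_pos hfin]
      omega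
    -- A longest word has no offspring in `U`, so it can be removed.
    obtain ⟨j, hj, hmax⟩ := Set.exists_max_image U List.length hfin hne
    have hU' : IsRootedSubtree (U \ {j}) := by
      intro i hi hi0
      refine ⟨hU i hi.1 hi0, fun h => ?_⟩
      rw [mem_singleton_iff] at h
      have h1 := hmax i hi.1
      rw [← h, List.length_dropLast] at h1
      have := List.length_pos_iff.2 hi0
      omega
    have hfin' : (U \ {j}).Finite := hfin.subset sdiff_subset
    have hjb : j ∈ boundary (U \ {j}) := by
      by_cases hj0 : j = []
      · refine Or.inl ⟨?_, hj0⟩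
        ext i
        simp only [mem_sdiff_singleton, mem_empty_iff_false, iff_false, not_and, not_not]
        intro hi
        have := hmax i hi
        rw [hj0] at this ⊢
        exact List.length_eq_zero_iff.1 (Nat.le_zero.1 this)
      · refine Or.inr ⟨by simp, hj0, hU j hj hj0, fun h => ?_⟩
        rw [mem_singleton_iff] at h
        have h1 := congrArg List.length h
        rw [List.length_dropLast] at h1
        have := List.length_pos_iff.2 hj0
        omega
    rw [← insert_sdiff_self_of_mem hj]
    refine hinsert _ _ hfin' hU' hjb (ih hfin' hU' ?_)
    rw [Set.ncard_sdiff_singleton_of_mem hj, hn]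
    rfl

/-- Adding a boundary point `j` to `U` splits the factor of the subtree above `j` into a mark and
two subtrees, by `map_decompose`. All independence statements follow from this product formula. -/
lemma IsRTP.measure_box {μ : Measure MTree} (hμ : IsRTP μ) {U : Set Tree} (hfin : U.Finite)
    (hU : IsRootedSubtree U) :
    ∃ V D : Finset Tree, (V : Set Tree) = U ∧ (D : Set Tree) = boundary U ∧
      ∀ (A : Tree → Set Mark) (B : Tree → Set MTree), (∀ i, MeasurableSet (A i)) →
        (∀ j, MeasurableSet (B j)) →
        μ {z | (∀ i ∈ U, (z i).1 ∈ A i) ∧ ∀ j ∈ boundary U, subtree j z ∈ B j} =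
          (∏ i ∈ V, markLaw (A i)) * ∏ j ∈ D, μ (B j) := by
  classical
  have := hμ.prob
  refine rootedSubtree_induction (C := fun U => ∃ V D : Finset Tree, (V : Set Tree) = U ∧
      (D : Set Tree) = boundary U ∧
      ∀ (A : Tree → Set Mark) (B : Tree → Set MTree), (∀ i, MeasurableSet (A i)) →
        (∀ j, MeasurableSet (B j)) →
        μ {z | (∀ i ∈ U, (z i).1 ∈ A i) ∧ ∀ j ∈ boundary U, subtree j z ∈ B j} =
          (∏ i ∈ V, markLaw (A i)) * ∏ j ∈ D, μ (B j)) ?_ ?_ hfin hU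
  · refine ⟨∅, {[]}, by simp, by simp [boundary_empty], fun A B _ _ => ?_⟩
    simp only [mem_empty_iff_false, boundary_empty, mem_singleton_iff, false_imp_iff,
      implies_true, true_and, forall_eq, Finset.prod_empty, one_mul, Finset.prod_singleton]
    rfl
  · rintro U j - hU hj ⟨V, D, rfl, hD, hform⟩
    have hjV : j ∉ V := by
      rcases hj with ⟨h, -⟩ | ⟨h, -⟩
      · simp_all
      · exact h
    have hjD : j ∈ D := by
      rw [← Finset.mem_coe, hD]
      exact hj
    have hchild : ∀ a : Letter, j ++ [a] ∉ D := by
      intro a h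
      rw [← Finset.mem_coe, hD] at h
      rcases h with ⟨-, h⟩ | ⟨-, -, h⟩
      · simp at h
      · exact hjV (by simpa using h)
    have h12 : j ++ [one] ≠ j ++ [two] := by simp
    refine ⟨insert j V, insert (j ++ [one]) (insert (j ++ [two]) (D.erase j)),
      by simp, by rw [boundary_insert hU hj, ← hD]; simp, fun A B hA hB => ?_⟩
    -- The conditions at `j` and above its two offspring are folded into one condition on the
    -- subtree above `j`, so that the formula for the smaller tree applies.
    set B' : Tree → Set MTree := Function.update B j
      (decompose ⁻¹' (A j ×ˢ (B (j ++ [one]) ×ˢ B (j ++ [two])))) with hB'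
    have hbox : MeasurableSet (A j ×ˢ (B (j ++ [one]) ×ˢ B (j ++ [two]))) :=
      (hA j).prod ((hB _).prod (hB _))
    have hB'm : ∀ i, MeasurableSet (B' i) := by
      intro i
      by_cases h : i = j
      · rw [h, hB', Function.update_self]
        exact measurable_decompose hbox
      · rw [hB', Function.update_of_ne h]
        exact hB i
    have hμB' : μ (B' j) = markLaw (A j) * (μ (B (j ++ [one])) * μ (B (j ++ [two]))) := by
      rw [hB', Function.update_self, hμ.measurePreserving.measure_preimage hbox.nullMeasurableSet,
        Measure.prod_prod, Measure.prod_prod]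
    have hBj : ∀ z : MTree, subtree j z ∈ B' j ↔ (z j).1 ∈ A j ∧
        subtree (j ++ [one]) z ∈ B (j ++ [one]) ∧ subtree (j ++ [two]) z ∈ B (j ++ [two]) := by
      intro z
      rw [hB', Function.update_self, ← subtree_subtree, ← subtree_subtree, mem_preimage]
      have h0 : (subtree j z []) = z j := by simp [subtree]
      simp only [decompose, mem_prod, h0]
      rfl
    have hev : {z : MTree | (∀ i ∈ insert j (V : Set Tree), (z i).1 ∈ A i) ∧
        ∀ i ∈ boundary (insert j (V : Set Tree)), subtree i z ∈ B i} =
        {z | (∀ i ∈ (V : Set Tree), (z i).1 ∈ A i) ∧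
          ∀ i ∈ boundary (V : Set Tree), subtree i z ∈ B' i} := by
      ext z
      simp only [mem_ofPred_eq, boundary_insert hU hj, forall_mem_insert, mem_sdiff_singleton]
      constructor
      · rintro ⟨⟨h1, h2⟩, h3, h4, h5⟩
        refine ⟨h2, fun i hi => ?_⟩
        by_cases h : i = j
        · rw [h]
          exact (hBj z).2 ⟨h1, h3, h4⟩
        · rw [hB', Function.update_of_ne h]
          exact h5 i ⟨hi, h⟩
      · rintro ⟨h2, h⟩
        obtain ⟨h1, h3, h4⟩ := (hBj z).1 (h j hj)
        refine ⟨⟨h1, h2⟩, h3, h4, fun i hi => ?_⟩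
        have := h i hi.1
        rwa [hB', Function.update_of_ne hi.2] at this
    rw [hev, hform A B' hA hB'm, ← Finset.mul_prod_erase D (fun i => μ (B' i)) hjD, hμB',
      Finset.prod_insert hjV, Finset.prod_insert, Finset.prod_insert]
    · have : ∏ i ∈ D.erase j, μ (B' i) = ∏ i ∈ D.erase j, μ (B i) :=
        Finset.prod_congr rfl fun i hi => by
          rw [hB', Function.update_of_ne (Finset.ne_of_mem_erase hi)]
      rw [this]
      ring
    · simp [hchild]
    · simp [hchild]

lemma IsRTP.map_mark {μ : Measure MTree} (hμ : IsRTP μ) (i : Tree) :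
    μ.map (fun z => (z i).1) = markLaw := by
  have := hμ.prob
  have h := (measurePreserving_fst.comp hμ.measurePreserving).comp (hμ.measurePreserving_subtree i)
  convert h.map_eq using 2
  funext z
  simp [decompose, subtree]

/-- The extension of a family of sets to a larger index set by the full set. -/
noncomputable def extendSets {ι α : Type*} {I : Set ι} (A : I → Set α) (i : ι) : Set α :=
  open Classical in if h : i ∈ I then A ⟨i, h⟩ else univ

lemma measurableSet_extendSets {ι α : Type*} [MeasurableSpace α] {I : Set ι} {A : I → Set α}
    (hA : ∀ i, MeasurableSet (A i)) (i : ι) : MeasurableSet (extendSets A i) := by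
  unfold extendSets
  split_ifs
  · exact hA _
  · exact MeasurableSet.univ

lemma extendSets_coe {ι α : Type*} {I : Set ι} (A : I → Set α) (i : I) :
    extendSets A (i : ι) = A i := by
  simp [extendSets]

lemma IsRTP.indepFun_boundary {μ : Measure MTree} (hμ : IsRTP μ) {U : Set Tree} (hfin : U.Finite)
    (hU : IsRootedSubtree U) :
    IndepFun (fun (z : MTree) (j : boundary U) => subtree (j : Tree) z)
      (fun (z : MTree) (i : U) => (z i).1) μ := by
  have := hμ.prob
  obtain ⟨V, D, hV, hD, hform⟩ := hμ.measure_box hfin hU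
  have : Finite U := hfin
  have : Finite (boundary U) := by
    rw [← hD]
    infer_instance
  refine indepFun_of_boxes (fun j => by fun_prop) (fun i => by fun_prop) fun B A hB hA => ?_
  have key : ∀ (A : U → Set Mark) (B : boundary U → Set MTree), (∀ i, MeasurableSet (A i)) →
      (∀ j, MeasurableSet (B j)) →
      μ ({z | ∀ j : boundary U, subtree (j : Tree) z ∈ B j} ∩ {z | ∀ i : U, (z i).1 ∈ A i}) =
        (∏ i ∈ V, markLaw (extendSets A i)) * ∏ j ∈ D, μ (extendSets B j) := by
    intro A B hA hB
    rw [← hform _ _ (measurableSet_extendSets hA) (measurableSet_extendSets hB)]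
    congr 1
    ext z
    simp only [mem_inter_iff, mem_ofPred_eq]
    rw [and_comm]
    refine and_congr ⟨fun h i hi => ?_, fun h i => ?_⟩ ⟨fun h i hi => ?_, fun h i => ?_⟩
    · rw [extendSets_coe A ⟨i, hi⟩]
      exact h ⟨i, hi⟩
    · rw [← extendSets_coe A]
      exact h i i.2
    · rw [extendSets_coe B ⟨i, hi⟩]
      exact h ⟨i, hi⟩
    · rw [← extendSets_coe B]
      exact h i i.2
  have huniv : ∀ {ι α : Type} {I : Set ι} (i : ι), extendSets (fun _ : I => (univ : Set α)) i = univ := by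
    intro ι α I i
    simp [extendSets]
  have kA := key A (fun _ => univ) hA fun _ => MeasurableSet.univ
  have kB := key (fun _ => univ) B (fun _ => MeasurableSet.univ) hB
  simp only [mem_univ, implies_true, ofPred_true, univ_inter, inter_univ, huniv, measure_univ,
    Finset.prod_const_one, mul_one, one_mul] at kA kB
  rw [key A B hA hB, kA, kB, mul_comm]

lemma IsRTP.iIndepFun_boundary {μ : Measure MTree} (hμ : IsRTP μ) {U : Set Tree} (hfin : U.Finite)
    (hU : IsRootedSubtree U) :
    iIndepFun (fun (j : boundary U) (z : MTree) => subtree (j : Tree) z) μ := by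
  have := hμ.prob
  obtain ⟨V, D, hV, hD, hform⟩ := hμ.measure_box hfin hU
  have hDfin : Finite (boundary U) := by
    rw [← hD]
    infer_instance
  have := Fintype.ofFinite (boundary U)
  rw [iIndepFun_iff_map_fun_eq_pi_map fun j => (measurable_subtree _).aemeasurable]
  simp only [(hμ.measurePreserving_subtree _).map_eq]
  refine (Measure.pi_eq fun B hB => ?_).symm
  have h := hform (fun _ => univ) (extendSets B) (fun _ => MeasurableSet.univ)
    (measurableSet_extendSets hB)
  rw [Measure.map_apply (measurable_pi_lambda _ fun j => measurable_subtree _)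
    (MeasurableSet.univ_pi hB)]
  have hprod : ∏ j : boundary U, μ (B j) = ∏ j ∈ D, μ (extendSets B j) := by
    refine Finset.prod_bij (fun j _ => (j : Tree)) (fun j _ => ?_) (fun i _ j _ h => Subtype.ext h)
      (fun j hj => ?_) fun j _ => by rw [extendSets_coe]
    · rw [← Finset.mem_coe, hD]
      exact j.2
    · rw [← Finset.mem_coe, hD] at hj
      exact ⟨⟨j, hj⟩, Finset.mem_univ _, rfl⟩
  simp only [mem_univ, implies_true, true_and, measure_univ, Finset.prod_const_one, one_mul] at h
  rw [hprod, ← h]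
  congr 1
  ext z
  simp only [mem_preimage, Set.mem_pi, mem_univ, true_imp_iff, mem_ofPred_eq]
  refine ⟨fun h i hi => ?_, fun h i => ?_⟩
  · rw [extendSets_coe B ⟨i, hi⟩]
    exact h ⟨i, hi⟩
  · rw [← extendSets_coe B]
    exact h i i.2

lemma isRootedSubtree_length_le (n : ℕ) : IsRootedSubtree {i : Tree | i.length ≤ n} := by
  intro i hi _
  have : i.dropLast.length ≤ i.length := by simp
  exact this.trans hi

lemma IsRTP.iIndepFun_mark {μ : Measure MTree} (hμ : IsRTP μ) :
    iIndepFun (fun (i : Tree) (z : MTree) => (z i).1) μ := by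
  classical
  have := hμ.prob
  rw [iIndepFun_iff_measure_inter_preimage_eq_mul]
  intro S A hA
  set n := S.sup List.length
  obtain ⟨V, D, hV, hD, hform⟩ :=
    hμ.measure_box (List.finite_length_le Letter n) (isRootedSubtree_length_le n)
  have hSV : S ⊆ V := fun i hi => by
    rw [← Finset.mem_coe, hV]
    exact Finset.le_sup (f := List.length) hi
  have hA' : ∀ i, MeasurableSet (if i ∈ S then A i else univ) := by
    intro i
    split_ifs with h
    · exact hA i h
    · exact MeasurableSet.univ
  have h := hform (fun i => if i ∈ S then A i else univ) (fun _ => univ) hA'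
    (fun _ => MeasurableSet.univ)
  simp only [mem_univ, implies_true, and_true, measure_univ, Finset.prod_const_one, mul_one] at h
  rw [← hV] at h
  have e1 : ∏ i ∈ S, μ ((fun z : MTree => (z i).1) ⁻¹' A i) = ∏ i ∈ S, markLaw (A i) :=
    Finset.prod_congr rfl fun i hi => by
      rw [← hμ.map_mark i, Measure.map_apply (by fun_prop) (hA i hi)]
  rw [e1]
  refine Eq.trans ?_ (h.trans ?_)
  · congr 1
    ext z
    simp only [mem_iInter, mem_preimage, mem_ofPred_eq]
    refine ⟨fun h i _ => ?_, fun h i hi => ?_⟩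
    · split_ifs with hi
      · exact h i hi
      · trivial
    · have := h i (hSV hi)
      rwa [if_pos hi] at this
  · rw [← Finset.prod_subset hSV fun i _ hi => by rw [if_neg hi, measure_univ]]
    exact Finset.prod_congr rfl fun i hi => by rw [if_pos hi]

/-! ### Existence of a nice solution -/

theorem IsRTP.isNiceSolution {Ξ : Set (Ioc (0 : ℝ) 1)} {μ : Measure MTree} (hμ : IsRTP μ)
    (hρ : IsFreezingLaw (Subtype.val '' Ξ) (μ.map rootTime)) :
    IsNiceSolution Ξ μ (fun z => (toPair z).1) (fun z => (toPair z).2) where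
  iid := ⟨fun i => by change Measurable fun z : MTree => (z i).1; fun_prop,
    hμ.iIndepFun_mark, hμ.map_mark⟩
  solution := ⟨fun i => (measurableSet_mem i).preimage (measurable_snd.comp measurable_toPair),
    hμ.ae_solvesFrozen hρ⟩
  stationary := by
    have h : ∀ j : Tree, μ.map (fun z => shift j (toPair z)) = μ.map toPair := by
      intro j
      simp only [← toPair_subtree]
      rw [← (hμ.measurePreserving_subtree j).map_eq,
        Measure.map_map measurable_toPair (measurable_subtree j)]
      rw [(hμ.measurePreserving_subtree j).map_eq]
      rfl
    intro j j'
    exact (h j).trans (h j').symm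
  adapted := by
    intro U hfin hU
    have h := (hμ.indepFun_boundary hfin hU).comp
      (φ := fun (f : boundary U → MTree) j => toPair (f j)) (ψ := id)
      (measurable_pi_lambda _ fun j => measurable_toPair.comp (measurable_pi_apply j)) measurable_id
    convert h using 1
    · funext z j
      exact (toPair_subtree _ _).symm
    · rfl
  respectsTree := by
    intro U hfin hU
    have h := (hμ.iIndepFun_boundary hfin hU).comp (fun _ => toPair) fun _ => measurable_toPair
    convert h using 1
    funext j z
    exact (toPair_subtree _ _).symm

/-- Closedness of `Ξ` in `(0,1]`, expressed in terms of the real line. -/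
lemma mem_image_of_mem_closure {Ξ : Set (Ioc (0 : ℝ) 1)} (hΞ : IsClosed Ξ) (x : ℝ)
    (hx : x ∈ Ioc (0 : ℝ) 1) (hxc : x ∈ closure (Subtype.val '' Ξ)) : x ∈ Subtype.val '' Ξ := by
  have h : (⟨x, hx⟩ : Ioc (0 : ℝ) 1) ∈ closure Ξ := closure_subtype.2 hxc
  rw [hΞ.closure_eq] at h
  exact ⟨_, h, rfl⟩

lemma image_val_subset (Ξ : Set (Ioc (0 : ℝ) 1)) : Subtype.val '' Ξ ⊆ Ioc 0 1 := by
  rintro _ ⟨x, -, rfl⟩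
  exact x.2

lemma IsFreezingLaw.ae_le_one_or {Ξ : Set ℝ} (hΞ : Ξ ⊆ Ioc 0 1) {ρ : Measure ℝ}
    (hρ : IsFreezingLaw Ξ ρ) : ∀ᵐ y ∂ρ, y ≤ 1 ∨ y = 2 := by
  have h : ∀ᵐ y ∂ρ, y ∈ Ξ ∪ {2} := hρ.support
  exact h.mono fun y hy => hy.imp (fun h => (hΞ h).2) id

theorem exists_isNiceSolution {Ξ : Set (Ioc (0 : ℝ) 1)} (hΞ : IsClosed Ξ) :
    ∃ μ : Measure MTree, IsProbabilityMeasure μ ∧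
      IsNiceSolution Ξ μ (fun z => (toPair z).1) (fun z => (toPair z).2) := by
  obtain ⟨ρ, hρ⟩ := exists_isFreezingLaw (image_val_subset Ξ) (mem_image_of_mem_closure hΞ)
  have := hρ.prob
  obtain ⟨μ, hμ, rfl⟩ := exists_isRTP
    (hρ.balanced.map_freezeStep (hρ.ae_le_one_or (image_val_subset Ξ)))
  exact ⟨μ, hμ.prob, hμ.isNiceSolution hρ⟩

/-! ### Percolation times of a given solution -/

/-- The infimum of a set of times, with the value `2` (that is, "never") for the empty set. -/
noncomputable def firstTime (T : Set ℝ) : ℝ := open Classical in if T.Nonempty then sInf T else 2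

section FirstTime

variable {T T' : Set ℝ}

lemma firstTime_empty : firstTime ∅ = 2 := by simp [firstTime]

lemma firstTime_of_nonempty (h : T.Nonempty) : firstTime T = sInf T := if_pos h

lemma bddBelow_of_subset_Ioc (hT : T ⊆ Ioc 0 1) : BddBelow T := ⟨0, fun _ hx => (hT hx).1.le⟩

lemma firstTime_le (hT : T ⊆ Ioc 0 1) {t : ℝ} (ht : t ∈ T) : firstTime T ≤ t := by
  rw [firstTime_of_nonempty ⟨t, ht⟩]
  exact csInf_le (bddBelow_of_subset_Ioc hT) ht

lemma firstTime_le_one_or (hT : T ⊆ Ioc 0 1) : firstTime T ≤ 1 ∨ firstTime T = 2 := by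
  rcases T.eq_empty_or_nonempty with rfl | ⟨t, ht⟩
  · exact Or.inr firstTime_empty
  · exact Or.inl ((firstTime_le hT ht).trans (hT ht).2)

lemma exists_lt_of_firstTime_lt {t : ℝ} (ht : t ≤ 2) (h : firstTime T < t) : ∃ s ∈ T, s < t := by
  rcases T.eq_empty_or_nonempty with rfl | hne
  · rw [firstTime_empty] at h
    linarith
  · rw [firstTime_of_nonempty hne] at h
    exact exists_lt_of_csInf_lt hne h

lemma firstTime_union (hT : T ⊆ Ioc 0 1) (hT' : T' ⊆ Ioc 0 1) :
    firstTime (T ∪ T') = min (firstTime T) (firstTime T') := by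
  have key : ∀ {T : Set ℝ}, T ⊆ Ioc 0 1 → firstTime T ≤ 2 := fun h => by
    rcases firstTime_le_one_or h with h | h <;> linarith
  rcases T.eq_empty_or_nonempty with rfl | h
  · rw [empty_union, firstTime_empty, min_eq_right (key hT')]
  rcases T'.eq_empty_or_nonempty with rfl | h'
  · rw [union_empty, firstTime_empty, min_eq_left (key hT)]
  rw [firstTime_of_nonempty h, firstTime_of_nonempty h', firstTime_of_nonempty (h.mono subset_union_left),
    csInf_union (bddBelow_of_subset_Ioc hT) h (bddBelow_of_subset_Ioc hT') h']

end FirstTime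

/-- The times in `Ξ` at which the root percolates. -/
def percTimes (Ξ : Set ℝ) (p : (Tree → Mark) × Set Tree) : Set ℝ := {t ∈ Ξ | PercolatesBy t p}

/-- The first time in `Ξ` at which the root percolates. -/
noncomputable def percTime (Ξ : Set ℝ) (p : (Tree → Mark) × Set Tree) : ℝ :=
  firstTime (percTimes Ξ p)

section PercTime

variable {Ξ : Set ℝ} {p : (Tree → Mark) × Set Tree}

lemma percTimes_subset (hΞ : Ξ ⊆ Ioc 0 1) : percTimes Ξ p ⊆ Ioc 0 1 := (sep_subset _ _).trans hΞ

/-- The set of times at which the root percolates is increasing and closed under limits from the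
right, so the infimum loses nothing. -/
lemma percTime_le_iff (hΞ : Ξ ⊆ Ioc 0 1) {t : ℝ} (ht : t ∈ Ξ) :
    percTime Ξ p ≤ t ↔ PercolatesBy t p := by
  refine ⟨fun h => ?_, fun h => firstTime_le (percTimes_subset hΞ) ⟨ht, h⟩⟩
  by_cases hex : ∃ s ∈ percTimes Ξ p, s ≤ t
  · obtain ⟨s, hs, hst⟩ := hex
    exact hs.2.mono hst
  · push Not at hex
    have ht1 := (hΞ ht).2
    refine percolatesBy_of_forall (T := percTimes Ξ p) (fun ε hε => ?_) fun s hs => hs.2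
    -- The cap at 2 excludes the default value of `firstTime` on the empty set.
    obtain ⟨s, hs, hst⟩ := exists_lt_of_firstTime_lt (T := percTimes Ξ p)
      (t := min (t + ε) 2) (min_le_right _ _) (lt_min (by linarith [show firstTime _ ≤ t from h])
        (by linarith [show firstTime _ ≤ t from h]))
    exact ⟨s, hs, hst.trans_le (min_le_left _ _)⟩

/-- A positive infimum is in `Ξ` by closedness in `(0,1]`. The value 0 must be excluded, since `Ξ`
may accumulate there. -/
lemma percTime_mem (hΞ : Ξ ⊆ Ioc 0 1) (hcl : ∀ x ∈ Ioc (0 : ℝ) 1, x ∈ closure Ξ → x ∈ Ξ)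
    (h0 : 0 < percTime Ξ p) : percTime Ξ p ∈ Ξ ∪ {2} := by
  rcases (percTimes Ξ p).eq_empty_or_nonempty with h | h
  · right
    rw [percTime, h, firstTime_empty]
    rfl
  · left
    rcases firstTime_le_one_or (percTimes_subset hΞ (p := p)) with h1 | h1
    · refine hcl _ ⟨h0, h1⟩ ?_
      rw [percTime, firstTime_of_nonempty h]
      exact closure_mono (sep_subset _ _)
        (csInf_mem_closure h (bddBelow_of_subset_Ioc (percTimes_subset hΞ)))
    · obtain ⟨t, ht⟩ := h
      have h2 := firstTime_le (percTimes_subset hΞ) ht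
      have h3 := (percTimes_subset hΞ ht).2
      linarith

lemma measurable_percTime (hΞ : Ξ ⊆ Ioc 0 1) : Measurable (percTime Ξ) := by
  obtain ⟨C, hCΞ, hC, hdense⟩ := exists_countable_right_dense Ξ
  refine measurable_of_Iio fun y => ?_
  rcases le_or_gt y 2 with hy | hy
  · have : percTime Ξ ⁻¹' Iio y = ⋃ t ∈ C, ⋃ _ : t < y, {p | PercolatesBy t p} := by
      ext p
      simp only [mem_preimage, mem_Iio, mem_iUnion, mem_ofPred_eq, exists_prop]
      constructor
      · intro h
        obtain ⟨t, ht, hty⟩ := exists_lt_of_firstTime_lt hy h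
        obtain ⟨s, hs, hts, hsy⟩ := hdense t ht.1 y hty
        exact ⟨s, hs, hsy, ht.2.mono hts⟩
      · rintro ⟨t, ht, hty, h⟩
        exact ((percTime_le_iff hΞ (hCΞ ht)).2 h).trans_lt hty
    rw [this]
    exact MeasurableSet.biUnion hC fun t _ => MeasurableSet.iUnion fun _ =>
      measurableSet_percolatesBy t
  · have : percTime Ξ ⁻¹' Iio y = univ := by
      refine eq_univ_of_forall fun p => ?_
      rcases firstTime_le_one_or (percTimes_subset hΞ (p := p)) with h | h
      · exact h.trans_lt (by linarith)
      · exact h.trans_lt hy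
    rw [this]
    exact MeasurableSet.univ

end PercTime

section Frozen

variable {Ξ : Set (Ioc (0 : ℝ) 1)} {p : (Tree → Mark) × Set Tree}

/-- In a solution of the frozen percolation equation, an internal point is frozen if and only if its
offspring percolates before the point is activated. -/
lemma SolvesFrozen.mem_iff (hΞ : IsClosed Ξ) (hp : SolvesFrozen Ξ p.1 p.2)
    (hτ : ∀ i, 0 < tau p.1 i) (i : Tree) :
    i ∈ p.2 ↔ (p.1 i).2 = one ∧ percTime (Subtype.val '' Ξ) (shift (i ++ [one]) p) ≤ (p.1 i).1 := by
  have hsub := image_val_subset Ξ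
  have hτi : (0 : ℝ) < (p.1 i).1 := hτ i
  have hτ1 : ((p.1 i).1 : ℝ) ≤ 1 := (p.1 i).1.2.2
  rw [hp i]
  refine and_congr_right fun _ => ⟨?_, fun h => ?_⟩
  · rintro ⟨t, ht, htτ, h⟩
    exact ((percTime_le_iff hsub ⟨t, ht, rfl⟩).2 ((percolatesBy_shift _ _ _).2 h)).trans htτ
  · suffices ∃ t ∈ percTimes (Subtype.val '' Ξ) (shift (i ++ [one]) p), t ≤ (p.1 i).1 by
      obtain ⟨_, ⟨⟨t, ht, rfl⟩, h⟩, hle⟩ := this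
      exact ⟨t, ht, hle, (percolatesBy_shift _ _ _).1 h⟩
    -- A first time equal to 0 is not attained, but then positivity of `τ` leaves room for an actual
    -- percolation time below `τ`.
    rcases le_or_gt (percTime (Subtype.val '' Ξ) (shift (i ++ [one]) p)) 0 with h0 | h0
    · obtain ⟨t, ht, hlt⟩ := exists_lt_of_firstTime_lt (by linarith) (lt_of_le_of_lt h0 hτi)
      exact ⟨t, ht, hlt.le⟩
    · rcases percTime_mem hsub (mem_image_of_mem_closure hΞ) h0 with hm | hm
      · exact ⟨_, ⟨hm, (percTime_le_iff hsub hm).1 le_rfl⟩, h⟩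
      · rw [mem_singleton_iff] at hm
        linarith

/-- In a solution of the frozen percolation equation, the percolation times satisfy the recursion
encoded in `freezeStep`. -/
lemma SolvesFrozen.percTime_eq (hΞ : IsClosed Ξ) (hp : SolvesFrozen Ξ p.1 p.2)
    (hτ : ∀ i, 0 < tau p.1 i) :
    percTime (Subtype.val '' Ξ) p = freezeStep (p.1 [], percTime (Subtype.val '' Ξ) (shift [one] p),
      percTime (Subtype.val '' Ξ) (shift [two] p)) := by
  have hsub := image_val_subset Ξ
  have hnil : [] ∈ p.2 ↔ _ := hp.mem_iff hΞ hτ []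
  rw [List.nil_append] at hnil
  have hperc : ∀ t, PercolatesBy t p ↔ _ := fun t => percolatesBy_iff
  simp only [nil_mem_openSet, hnil] at hperc
  rcases eq_one_or_eq_two (p.1 []).2 with hk | hk
  · have hle : ∀ a : Letter, a ≤ one ↔ a = one := by decide
    simp only [hk, hle, true_and, forall_true_left, exists_eq_left, not_le] at hperc
    simp only [freezeStep, hk, if_true]
    split_ifs with h
    · have : percTimes (Subtype.val '' Ξ) p = ∅ := by
        refine eq_empty_of_forall_notMem fun t ht => ?_
        exact absurd h (not_le.2 ((hperc t).1 ht.2).1.2)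
      rw [percTime, this, firstTime_empty]
    -- If the root is not frozen, its activation costs nothing: `τ < Y_1 ≤ t` whenever the offspring
    -- percolates at `t ∈ Ξ`.
    · have : percTimes (Subtype.val '' Ξ) p = percTimes (Subtype.val '' Ξ) (shift [one] p) := by
        ext t
        refine and_congr_right fun ht => ?_
        rw [hperc]
        refine ⟨fun h => h.2, fun ht' => ⟨⟨?_, not_le.1 h⟩, ht'⟩⟩
        exact (not_le.1 h).le.trans ((percTime_le_iff hsub ht).2 ht')
      rw [percTime, this, percTime]
  · have hle : ∀ a : Letter, a ≤ two := by decide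
    simp only [hk, hle, one_ne_two.symm, false_and, false_imp_iff, not_false_eq_true, true_and]
      at hperc
    simp only [freezeStep, hk, one_ne_two.symm, if_false]
    rw [percTime, percTime, percTime,
      ← firstTime_union (percTimes_subset hsub) (percTimes_subset hsub)]
    congr 1
    ext t
    simp only [percTimes, mem_union, mem_ofPred_eq, hperc, ← and_or_left]
    refine and_congr_right fun _ => ⟨?_, ?_⟩
    · rintro ⟨a, ha⟩
      rcases eq_one_or_eq_two a with rfl | rfl
      · exact Or.inl ha
      · exact Or.inr ha
    · rintro (h | h)
      · exact ⟨_, h⟩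
      · exact ⟨_, h⟩

end Frozen

/-! ### Uniqueness in law of nice solutions -/

/-- The tree of marks and percolation times as a function of `(Ω, 𝔽)`. -/
noncomputable def withTimes (Ξ : Set ℝ) (p : (Tree → Mark) × Set Tree) : MTree :=
  fun i => (p.1 i, percTime Ξ (shift i p))

lemma measurable_withTimes {Ξ : Set ℝ} (hΞ : Ξ ⊆ Ioc 0 1) : Measurable (withTimes Ξ) :=
  measurable_pi_lambda _ fun i => Measurable.prodMk (by fun_prop)
    ((measurable_percTime hΞ).comp (measurable_shift i))

lemma branch_withTimes (Ξ : Set ℝ) (a : Letter) (p : (Tree → Mark) × Set Tree) :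
    branch a (withTimes Ξ p) = withTimes Ξ (shift [a] p) := by
  funext i
  simp only [branch, withTimes, shift_shift]
  rfl

/-- The frozen set carries no randomness beyond marks and percolation times, so the law of `(Ω, 𝔽)`
is an image of the law of the tree of marks and times. -/
lemma SolvesFrozen.toPair_withTimes {Ξ : Set (Ioc (0 : ℝ) 1)} {p : (Tree → Mark) × Set Tree}
    (hΞ : IsClosed Ξ) (hp : SolvesFrozen Ξ p.1 p.2) (hτ : ∀ i, 0 < tau p.1 i) :
    toPair (withTimes (Subtype.val '' Ξ) p) = p := by
  refine Prod.ext rfl ?_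
  ext i
  exact (hp.mem_iff hΞ hτ i).symm

section Nice

variable {S : Type*} [MeasurableSpace S] {P : Measure S}
  {ω : S → Tree → Mark} {F : S → Set Tree} {Ξ : Set (Ioc (0 : ℝ) 1)}

lemma IsNiceSolution.measurable (h : IsNiceSolution Ξ P ω F) : Measurable fun s => (ω s, F s) :=
  (measurable_pi_lambda _ h.iid.measurable).prodMk (measurable_set_iff.2 fun i =>
    measurableSet_setOfPred.1 (h.solution.measurable i))

lemma IsNiceSolution.map_shift (h : IsNiceSolution Ξ P ω F) (j : Tree) :
    P.map (fun s => shift j (ω s, F s)) = P.map fun s => (ω s, F s) :=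
  h.stationary j []

lemma IsNiceSolution.ae_tau_pos (h : IsNiceSolution Ξ P ω F) : ∀ᵐ s ∂P, ∀ i, 0 < tau (ω s) i := by
  rw [ae_all_iff]
  intro i
  have h0 : ∀ᵐ m ∂markLaw, (0 : ℝ) < m.1 := by
    have hv : ∀ᵐ x : unitInterval, (0 : ℝ) < x := by
      rw [ae_iff]
      simp
    exact measurePreserving_fst.quasiMeasurePreserving.ae hv
  rw [← h.iid.law i] at h0
  exact ae_of_ae_map (h.iid.measurable i).aemeasurable h0

lemma IsNiceSolution.ae_solvesFrozen (h : IsNiceSolution Ξ P ω F) :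
    ∀ᵐ s ∂P, SolvesFrozen Ξ (ω s) (F s) ∧ ∀ i, 0 < tau (ω s) i :=
  h.solution.solves.and h.ae_tau_pos

lemma IsNiceSolution.map_toPair (h : IsNiceSolution Ξ P ω F) (hΞ : IsClosed Ξ) :
    P.map (fun s => (ω s, F s)) =
      (P.map fun s => withTimes (Subtype.val '' Ξ) (ω s, F s)).map toPair := by
  have hm : Measurable fun s => withTimes (Subtype.val '' Ξ) (ω s, F s) :=
    (measurable_withTimes (image_val_subset Ξ)).comp h.measurable
  rw [Measure.map_map measurable_toPair hm]
  refine Measure.map_congr ?_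
  filter_upwards [h.ae_solvesFrozen] with s hs
  exact (SolvesFrozen.toPair_withTimes (p := (ω s, F s)) hΞ hs.1 hs.2).symm

variable [IsProbabilityMeasure P]

/-- In a nice solution, the mark of the root and the solutions above the two offspring of the root
are independent. -/
lemma IsNiceSolution.map_mark_shift (h : IsNiceSolution Ξ P ω F) :
    P.map (fun s => (ω s [], shift [one] (ω s, F s), shift [two] (ω s, F s))) =
      markLaw.prod ((P.map fun s => (ω s, F s)).prod (P.map fun s => (ω s, F s))) := by
  -- The adaptedness and tree-respecting conditions enter only through `U = {∅}`; stationarity then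
  -- identifies the laws above the two offspring.
  have hroot : IsRootedSubtree {[]} := by
    intro i hi hi0
    exact absurd hi hi0
  have hb : ∀ a : Letter, [a] ∈ boundary {[]} := fun a => Or.inr (by simp)
  have hmeas : ∀ j, Measurable fun s => shift j (ω s, F s) := fun j =>
    (measurable_shift j).comp h.measurable
  have h1 : IndepFun (fun s => shift [one] (ω s, F s)) (fun s => shift [two] (ω s, F s)) P :=
    (h.respectsTree {[]} (finite_singleton _) hroot).indepFun
      (i := ⟨[one], hb one⟩) (j := ⟨[two], hb two⟩) (by simp)
  have h2 : IndepFun (fun s => (shift [one] (ω s, F s), shift [two] (ω s, F s))) (fun s => ω s []) P :=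
    (h.adapted {[]} (finite_singleton _) hroot).comp
      (φ := fun f => (f ⟨[one], hb one⟩, f ⟨[two], hb two⟩)) (ψ := fun f => f ⟨[], rfl⟩)
      ((measurable_pi_apply _).prodMk (measurable_pi_apply _)) (measurable_pi_apply _)
  rw [(indepFun_iff_map_prod_eq_prod_map_map (h.iid.measurable []).aemeasurable
    ((hmeas _).prodMk (hmeas _)).aemeasurable).1 h2.symm, h.iid.law,
    (indepFun_iff_map_prod_eq_prod_map_map (hmeas _).aemeasurable (hmeas _).aemeasurable).1 h1,
    h.map_shift, h.map_shift]

/-- Adding the times commutes with passing to a branch, so the independence at the root carries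
over; the recursion is `SolvesFrozen.percTime_eq`. -/
lemma IsNiceSolution.isRTP (h : IsNiceSolution Ξ P ω F) (hΞ : IsClosed Ξ) :
    IsRTP (P.map fun s => withTimes (Subtype.val '' Ξ) (ω s, F s)) := by
  have hsub := image_val_subset Ξ
  have hm : Measurable fun s => withTimes (Subtype.val '' Ξ) (ω s, F s) :=
    (measurable_withTimes hsub).comp h.measurable
  have hprob : IsProbabilityMeasure (P.map fun s => (ω s, F s)) :=
    Measure.isProbabilityMeasure_map h.measurable.aemeasurable
  refine ⟨Measure.isProbabilityMeasure_map hm.aemeasurable, ?_, ?_⟩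
  · have hθ := measurable_withTimes hsub
    have e : P.map (fun s => withTimes (Subtype.val '' Ξ) (ω s, F s)) =
        (P.map fun s => (ω s, F s)).map (withTimes (Subtype.val '' Ξ)) :=
      (Measure.map_map hθ h.measurable).symm
    have hdec : decompose ∘ (fun s => withTimes (Subtype.val '' Ξ) (ω s, F s)) =
        (Prod.map id (Prod.map (withTimes (Subtype.val '' Ξ)) (withTimes (Subtype.val '' Ξ)))) ∘
          fun s => (ω s [], shift [one] (ω s, F s), shift [two] (ω s, F s)) := by
      funext s
      simp only [Function.comp, decompose, branch_withTimes]
      rfl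
    have hmeas : ∀ j, Measurable fun s => shift j (ω s, F s) := fun j =>
      (measurable_shift j).comp h.measurable
    rw [Measure.map_map measurable_decompose hm, hdec,
      ← Measure.map_map (measurable_id.prodMap (hθ.prodMap hθ))
        ((h.iid.measurable []).prodMk ((hmeas _).prodMk (hmeas _))), h.map_mark_shift, e,
      Measure.map_prod_map _ _ hθ hθ]
    nth_rewrite 2 [← Measure.map_id (μ := markLaw)]
    rw [Measure.map_prod_map _ _ measurable_id (hθ.prodMap hθ)]
  · rw [ae_map_iff hm.aemeasurable (measurableSet_eq_fun (by fun_prop) (by fun_prop))]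
    filter_upwards [h.ae_solvesFrozen] with s hs
    rw [branch_withTimes, branch_withTimes]
    exact SolvesFrozen.percTime_eq (p := (ω s, F s)) hΞ hs.1 hs.2

lemma IsNiceSolution.isFreezingLaw (h : IsNiceSolution Ξ P ω F) (hΞ : IsClosed Ξ) :
    IsFreezingLaw (Subtype.val '' Ξ)
      ((P.map fun s => withTimes (Subtype.val '' Ξ) (ω s, F s)).map rootTime) := by
  have hsub := image_val_subset Ξ
  have hm : Measurable fun s => withTimes (Subtype.val '' Ξ) (ω s, F s) :=
    (measurable_withTimes hsub).comp h.measurable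
  have hμ := h.isRTP hΞ
  have := hμ.prob
  set μ := P.map fun s => withTimes (Subtype.val '' Ξ) (ω s, F s) with hμdef
  have hprob : IsProbabilityMeasure (μ.map rootTime) :=
    Measure.isProbabilityMeasure_map measurable_rootTime.aemeasurable
  have hlaw : μ.map rootTime = P.map fun s => percTime (Subtype.val '' Ξ) (ω s, F s) := by
    rw [hμdef, Measure.map_map measurable_rootTime hm]
    rfl
  have hpm : Measurable fun s => percTime (Subtype.val '' Ξ) (ω s, F s) :=
    (measurable_percTime hsub).comp h.measurable
  have hle : ∀ᵐ y ∂μ.map rootTime, y ≤ 1 ∨ y = 2 := by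
    rw [hlaw]
    refine (ae_map_iff hpm.aemeasurable (measurableSet_Iic.union (measurableSet_singleton 2))).2 ?_
    exact ae_of_all _ fun s => firstTime_le_one_or (percTimes_subset hsub)
  have hbal := isBalanced_of_map_freezeStep hle hμ.map_freezeStep
  refine ⟨hprob, ?_, hbal, fun t ht => ?_⟩
  -- Balance at 0 gives `G(0)² = 0`, as `ENNReal.ofReal` vanishes on `Iic 0`. This rules out the
  -- value 0, and closedness gives the support.
  · have h0 : μ.map rootTime (Iic 0) = 0 := by
      have hb := hbal 0 (by norm_num)
      have hz : ∫⁻ y in Iic 0, ENNReal.ofReal y ∂μ.map rootTime = 0 := by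
        rw [setLIntegral_congr_fun measurableSet_Iic (g := fun _ => 0)
          fun y hy => ENNReal.ofReal_of_nonpos hy]
        simp
      rw [hz] at hb
      exact pow_eq_zero_iff (two_ne_zero) |>.1 hb
    have hpos : ∀ᵐ s ∂P, 0 < percTime (Subtype.val '' Ξ) (ω s, F s) := by
      rw [hlaw] at h0
      have := ae_of_ae_map hpm.aemeasurable (measure_eq_zero_iff_ae_notMem.1 h0)
      exact this.mono fun s hs => not_le.1 hs
    have hsupp : ∀ᵐ s ∂P, percTime (Subtype.val '' Ξ) (ω s, F s) ∈ Subtype.val '' Ξ ∪ {2} :=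
      hpos.mono fun s hs => percTime_mem hsub (mem_image_of_mem_closure hΞ) hs
    have hcl : MeasurableSet (Subtype.val '' Ξ) :=
      (MeasurableEmbedding.subtype_coe measurableSet_Ioc).measurableSet_image.2 hΞ.measurableSet
    rw [hlaw]
    exact (ae_map_iff hpm.aemeasurable (hcl.union (measurableSet_singleton 2))).2 hsupp
  · have htI := hsub ht
    -- By definition of the first percolation time, a root percolating at `t ∈ Ξ` has time at most
    -- `t`; `IsRTP.le_two_mul` turns this into the lower bound.
    have hae : ∀ᵐ z ∂μ, PercolatesBy t (toPair z) → rootTime z ≤ t := by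
      refine (ae_map_iff hm.aemeasurable ((measurable_toPair (measurableSet_percolatesBy t)).imp
        (measurableSet_le measurable_rootTime measurable_const))).2 ?_
      filter_upwards [h.ae_solvesFrozen] with s hs hperc
      rw [SolvesFrozen.toPair_withTimes (p := (ω s, F s)) hΞ hs.1 hs.2] at hperc
      exact (percTime_le_iff hsub ht).2 hperc
    have hreal := hμ.le_two_mul htI.1.le htI.2 hae
    rw [ENNReal.ofReal_le_iff_le_toReal (by finiteness)]
    simpa [Measure.real] using hreal

end Nice

theorem IsNiceSolution.map_eq {S S' : Type*} [MeasurableSpace S] [MeasurableSpace S']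
    {P : Measure S} {P' : Measure S'} [IsProbabilityMeasure P] [IsProbabilityMeasure P']
    {ω : S → Tree → Mark} {F : S → Set Tree} {ω' : S' → Tree → Mark} {F' : S' → Set Tree}
    {Ξ : Set (Ioc (0 : ℝ) 1)} (hΞ : IsClosed Ξ) (h : IsNiceSolution Ξ P ω F)
    (h' : IsNiceSolution Ξ P' ω' F') :
    P.map (fun s => (ω s, F s)) = P'.map (fun s => (ω' s, F' s)) := by
  rw [h.map_toPair hΞ, h'.map_toPair hΞ, (h.isRTP hΞ).unique (h'.isRTP hΞ)
    ((h.isFreezingLaw hΞ).unique (image_val_subset Ξ) (h'.isFreezingLaw hΞ))]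

end FrozenPerc

theorem theorem1 (Ξ : Set (Set.Ioc (0 : ℝ) 1)) (hΞ : IsClosed Ξ) :
    (∃ (S : Type) (_ : MeasurableSpace S) (P : Measure S) (_ : IsProbabilityMeasure P)
        (ω : S → FrozenPerc.Tree → FrozenPerc.Mark) (F : S → Set FrozenPerc.Tree),
        FrozenPerc.IsNiceSolution Ξ P ω F) ∧
    (∀ (S : Type*) (S' : Type*) [MeasurableSpace S] [MeasurableSpace S']
        (P : Measure S) (P' : Measure S') [IsProbabilityMeasure P] [IsProbabilityMeasure P']
        (ω : S → FrozenPerc.Tree → FrozenPerc.Mark) (F : S → Set FrozenPerc.Tree)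
        (ω' : S' → FrozenPerc.Tree → FrozenPerc.Mark) (F' : S' → Set FrozenPerc.Tree),
        FrozenPerc.IsNiceSolution Ξ P ω F → FrozenPerc.IsNiceSolution Ξ P' ω' F' →
          P.map (fun s => (ω s, F s)) = P'.map (fun s => (ω' s, F' s))) := by
  refine ⟨?_, fun S S' _ _ P P' _ _ ω F ω' F' h h' => h.map_eq hΞ h'⟩
  obtain ⟨μ, hμ, h⟩ := FrozenPerc.exists_isNiceSolution hΞ
  exact ⟨FrozenPerc.MTree, inferInstance, μ, hμ, _, _, h⟩
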